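/- Let $\mathcal X,\mathcal Z$ be complex Hilbert spaces, $E\in L(\mathcal X,\mathcal Z)$, and let $A\colon\mathcal D(A)\subseteq\mathcal X\to\mathcal Z$ be closed and densely defined. Suppose that $(E,A)$ has a Weierstraß form: there are Hilbert spaces $\mathcal Y^1,\mathcal Y^2$, bounded isomorphisms $P\colon\mathcal X\to\mathcal Y^1\oplus\mathcal Y^2$ and $Q\colon\mathcal Z\to\mathcal Y^1\oplus\mathcal Y^2$, a bounded nilpotent operator $N$ on $\mathcal Y^2$ and a linear operator $A_1\colon\mathcal D(A_1)\subseteq\mathcal Y^1\to\mathcal Y^1$ with $$E=Q^{-1}\begin{bmatrix}I&0\\0&N\end{bmatrix}P,\qquad A=Q^{-1}\begin{bmatrix}A_1&0\\0&I\end{bmatrix}P$$ (the second identity including domains). If $A_1$ generates a $C_0$-semigroup on $\mathcal Y^1$, then all the indices below exist, and $$p_{\rm res}=p_{\rm nilp}=p_{\rm diff}=p_{\rm chain}=p_{\rm pert}.$$ If moreover $\mathcal Y^2\neq\{0\}$ (equivalently $\ker E\neq\{0\}$), then also $p_{\rm rad}+1=p_{\rm res}$; if $\mathcal Y^2=\{0\}$,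 then $p_{\rm rad}$ and all the other indices are $0$. Here $\mathbb N=\{0,1,2,\dots\}$, $\rho(E,A)$ is the set of $\lambda\in\mathbb C$ for which $\lambda E-A\colon\mathcal D(A)\to\mathcal Z$ has a bounded inverse in $L(\mathcal Z,\mathcal X)$, and: * $p_{\rm res}$ is the least $p\in\mathbb N$ such that for some $\omega\in\mathbb R$, $C>0$ one has $(\omega,\infty)\subseteq\rho(E,A)$ and $\|(\lambda E-A)^{-1}\|\le C|\lambda|^{p-1}$ for all $\lambda>\omega$. * $p_{\rm rad}$ is the least $p\in\mathbb N$ such that for some $\omega,C>0$ one has $(\omega,\infty)\subseteq\rho(E,A)$ and, for all $\lambda_0,\dots,\lambda_p>\omega$, the operators $(\lambda_0E-A)^{-1}E\cdots(\lambda_pE-A)^{-1}E$ and $E(\lambda_0E-A)^{-1}\cdots E(\lambda_pE-A)^{-1}$ have norm at most $C\prod_{k=0}^p|\lambda_k-\omega|^{-1}$. * $p_{\rm nilp}$ is the nilpotency degree $\min\{k\in\mathbb N: N^k=0\}$ of $N$, which is the same for every Weierstraß form of $(E,A)$ (it is $0$ if $\mathcal Y^2=\{0\}$). * $p_{\rm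 diff}$ is the least $p\in\mathbb N$ such that the derivative array $Ex_{i+1}=Ax_i+f_i$, $i=0,\dots,p$ (with $x_0,\dots,x_p\in\mathcal D(A)$, $x_{p+1}\in\mathcal X$, $f_i\in\mathcal Z$) determines $x_1$ uniquely from $x_0$ and $f_0,\dots,f_p$; its existence includes that, for this $p$, the array implies $x_0\in\mathcal D(S)$ and $x_1=Sx_0+\sum_{i=0}^pG_if_i$ for some generator $S$ of a $C_0$-semigroup on $\mathcal X$ and some $G_i\in L(\mathcal Z,\mathcal X)$. * $p_{\rm chain}$ is the supremum of the lengths $l\ge1$ of chains $(x_1,\dots,x_l)$, i.e. $0\ne x_1\in\ker E$, $x_i\in\mathcal D(A)$ and $Ex_{i+1}=Ax_i$ for $1\le i<l$ ($x_l\in\mathcal X$); it is $0$ if there are no chains. * $p_{\rm pert}$ is the least $p\in\mathbb N$ such that there is a $c>0$ with $$\max_{0\le t\le T}\|x(t)\|\le c\Big(\|x(0)\|+\sum_{i=0}^{p-1}\max_{0\le t\le T}\|\delta^{(i)}(t)\|\Big)$$ for all $\delta\in C^{p-1}([0,T];\mathcal Z)$ and all classical solutions $x$ of $\frac{d}{dt}Ex=Ax+\delta$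 on $[0,T]$ ($x$ continuous on $[0,T]$ with values in $\mathcal D(A)$, $Ex$ continuously differentiable on $(0,T]$, the equation holding on $(0,T]$); for $p=0$, $\delta$ is continuous and the sum is replaced by $\int_0^T\|\delta(t)\|\,dt$. This $p$ is the same for every $T>0$. -/

import Mathlib

universe u v w u' v'

open Set Filter Topology

namespace DAE

/-! Linear differential-algebraic equations `d/dt E x(t) = A x(t)` with `E : X → Z` bounded and
`A : D(A) ⊆ X → Z` an unbounded operator. -/

section Basic

variable {X : Type u} [NormedAddCommGroup X] [InnerProductSpace ℂ X]
  {Z : Type v} [NormedAddCommGroup Z] [InnerProductSpace ℂ Z]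
  {X' : Type u'} [NormedAddCommGroup X'] [InnerProductSpace ℂ X']
  {Z' : Type v'} [NormedAddCommGroup Z'] [InnerProductSpace ℂ Z']

/-- `(E, A) ∼ (E', A')`: there are bounded isomorphisms `P`, `Q` with `E = Q⁻¹ E' P` and
`A = Q⁻¹ A' P`. The second identity is one of unbounded operators, equality of domains included,
and is therefore written with graphs. -/
def Equivalent (E : X →L[ℂ] Z) (A : X →ₗ.[ℂ] Z) (E' : X' →L[ℂ] Z') (A' : X' →ₗ.[ℂ] Z') : Prop :=
  ∃ (P : X ≃L[ℂ] X') (Q : Z ≃L[ℂ] Z'),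
    (∀ x, E x = Q.symm (E' (P x))) ∧
    ∀ x z, (x, z) ∈ A.graph ↔ (P x, Q z) ∈ A'.graph

/-- `R` is the bounded everywhere defined inverse of `lam E - A : D(A) → Z`. -/
def IsResolventAt (E : X →L[ℂ] Z) (A : X →ₗ.[ℂ] Z) (lam : ℂ) (R : Z →L[ℂ] X) : Prop :=
  (∀ z, ∃ h : R z ∈ A.domain, lam • E (R z) - A ⟨R z, h⟩ = z) ∧
    ∀ x : A.domain, R (lam • E x - A x) = x

/-- The resolvent set `ρ(E, A)`. -/
def resolventSet (E : X →L[ℂ] Z) (A : X →ₗ.[ℂ] Z) : Set ℂ :=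
  {lam | ∃ R, IsResolventAt E A lam R}

open Classical in
/-- `(lam E - A)⁻¹`, and `0` for `lam` outside `ρ(E, A)`. -/
noncomputable def resolvent (E : X →L[ℂ] Z) (A : X →ₗ.[ℂ] Z) (lam : ℂ) : Z →L[ℂ] X :=
  if h : ∃ R, IsResolventAt E A lam R then h.choose else 0

theorem isResolventAt_resolvent {E : X →L[ℂ] Z} {A : X →ₗ.[ℂ] Z} {lam : ℂ}
    (h : lam ∈ resolventSet E A) : IsResolventAt E A lam (resolvent E A lam) := by
  have h' : ∃ R, IsResolventAt E A lam R := h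
  rw [resolvent, dif_pos h']
  exact h'.choose_spec

theorem IsResolventAt.eq_resolvent {E : X →L[ℂ] Z} {A : X →ₗ.[ℂ] Z} {lam : ℂ} {R : Z →L[ℂ] X}
    (h : IsResolventAt E A lam R) : R = resolvent E A lam := by
  have h' := isResolventAt_resolvent (E := E) (A := A) (lam := lam) ⟨R, h⟩
  ext z
  obtain ⟨hd, hz⟩ := h'.1 z
  have := h.2 ⟨_, hd⟩
  rwa [hz] at this

/-- `A` is the generator of a `C₀`-semigroup `(T t)_{t ≥ 0}` of bounded operators on `X`: its
graph consists of all `(x, y)` with `(T t x - x) / t → y` as `t ↓ 0`. -/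
def GeneratesC0Semigroup (A : X →ₗ.[ℂ] X) : Prop :=
  ∃ T : ℝ → X →L[ℂ] X,
    T 0 = ContinuousLinearMap.id ℂ X ∧
    (∀ s t, 0 ≤ s → 0 ≤ t → T (s + t) = (T s).comp (T t)) ∧
    (∀ x, ContinuousOn (fun t => T t x) (Ici 0)) ∧
    ∀ x y, (x, y) ∈ A.graph ↔ Tendsto (fun t : ℝ => t⁻¹ • (T t x - x)) (𝓝[>] 0) (𝓝 y)

/-! ### Resolvent index -/

/-- `(ω, ∞) ⊆ ρ(E, A)` and `‖(lam E - A)⁻¹‖ ≤ C |lam| ^ (p - 1)` on `(ω, ∞)`; the exponent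
`p - 1` is an integer and equals `-1` for `p = 0`. -/
def HasResolventBound (E : X →L[ℂ] Z) (A : X →ₗ.[ℂ] Z) (p : ℕ) : Prop :=
  ∃ ω C : ℝ, 0 < C ∧ ∀ lam : ℝ, ω < lam →
    (lam : ℂ) ∈ resolventSet E A ∧ ‖resolvent E A lam‖ ≤ C * |lam| ^ ((p : ℤ) - 1)

def IsResolventIndex (E : X →L[ℂ] Z) (A : X →ₗ.[ℂ] Z) (p : ℕ) : Prop :=
  IsLeast {q | HasResolventBound E A q} p

/-! ### Radiality index -/

/-- `(ω, ∞) ⊆ ρ(E, A)` and, for all `l 0, …, l p > ω`, the products (in this order) of the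
operators `(l k E - A)⁻¹ E` and of the operators `E (l k E - A)⁻¹` have norm at most
`C / ∏ |l k - ω|`. -/
def HasRadialityBound (E : X →L[ℂ] Z) (A : X →ₗ.[ℂ] Z) (p : ℕ) : Prop :=
  ∃ ω C : ℝ, 0 < ω ∧ 0 < C ∧ (∀ lam : ℝ, ω < lam → (lam : ℂ) ∈ resolventSet E A) ∧
    ∀ l : Fin (p + 1) → ℝ, (∀ k, ω < l k) →
      ‖(List.ofFn fun k => (resolvent E A (l k)).comp E).prod‖ ≤ C / ∏ k, |l k - ω| ∧
      ‖(List.ofFn fun k => E.comp (resolvent E A (l k))).prod‖ ≤ C / ∏ k, |l k - ω|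

def IsRadialityIndex (E : X →L[ℂ] Z) (A : X →ₗ.[ℂ] Z) (p : ℕ) : Prop :=
  IsLeast {q | HasRadialityBound E A q} p

/-! ### Differentiation index -/

/-- The `p`-th derivative array of `E x' = A x + f`, that is, the equation and its first `p`
formal derivatives `E x⁽ⁱ⁺¹⁾ = A x⁽ⁱ⁾ + f⁽ⁱ⁾`, `i = 0, …, p`, with `x i` and `f i` in place of
`x⁽ⁱ⁾` and `f⁽ⁱ⁾`. Only `x 0, …, x (p + 1)` and `f 0, …, f p` enter. -/
def DerivativeArray (E : X →L[ℂ] Z) (A : X →ₗ.[ℂ] Z) (p : ℕ) (x : ℕ → X) (f : ℕ → Z) : Prop :=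
  ∀ i ≤ p, ∃ h : x i ∈ A.domain, E (x (i + 1)) = A ⟨x i, h⟩ + f i

/-- The `p`-th derivative array determines `x'` as a function of `x` and of the inhomogeneity. -/
def DeterminesDerivative (E : X →L[ℂ] Z) (A : X →ₗ.[ℂ] Z) (p : ℕ) : Prop :=
  ∀ (x y : ℕ → X) (f : ℕ → Z), DerivativeArray E A p x f → DerivativeArray E A p y f →
    x 0 = y 0 → x 1 = y 1

/-- The `p`-th derivative array implies an abstract ordinary differential equation
`x' = S x + G₀ f + G₁ f' + … + G_p f⁽ᵖ⁾`, where `S` generates a `C₀`-semigroup on `X` and the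
`G i` are bounded. -/
def HasUnderlyingODE (E : X →L[ℂ] Z) (A : X →ₗ.[ℂ] Z) (p : ℕ) : Prop :=
  ∃ (S : X →ₗ.[ℂ] X) (G : ℕ → Z →L[ℂ] X), GeneratesC0Semigroup S ∧
    ∀ (x : ℕ → X) (f : ℕ → Z), DerivativeArray E A p x f →
      ∃ h : x 0 ∈ S.domain, x 1 = S ⟨x 0, h⟩ + ∑ i ∈ Finset.range (p + 1), G i (f i)

/-- `p` is the least number of differentiations after which `x'` is determined by `x` and the
inhomogeneity, and the ordinary differential equation so obtained is governed by a
`C₀`-semigroup. -/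
def IsDifferentiationIndex (E : X →L[ℂ] Z) (A : X →ₗ.[ℂ] Z) (p : ℕ) : Prop :=
  IsLeast {q | DeterminesDerivative E A q} p ∧ HasUnderlyingODE E A p

/-! ### Chain index -/

/-- There is a chain of length `l ≥ 1`, that is, `x 0, …, x (l - 1)` with `0 ≠ x 0 ∈ ker E` and
`E (x (i + 1)) = A (x i)`. -/
def HasChainOfLength (E : X →L[ℂ] Z) (A : X →ₗ.[ℂ] Z) (l : ℕ) : Prop :=
  0 < l ∧ ∃ x : ℕ → X, x 0 ≠ 0 ∧ E (x 0) = 0 ∧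
    ∀ i, i + 1 < l → ∃ h : x i ∈ A.domain, E (x (i + 1)) = A ⟨x i, h⟩

/-- The chain index is the supremum in `ℕ` of the lengths of chains, in particular `0` if there
are none. -/
def IsChainIndex (E : X →L[ℂ] Z) (A : X →ₗ.[ℂ] Z) (p : ℕ) : Prop :=
  IsLUB {l | HasChainOfLength E A l} p

/-! ### Perturbation index -/

/-- `x` is a classical solution on `[0, T]` of `d/dt E x(t) = A x(t) + δ(t)`: `x` is continuous on
`[0, T]` with values in `D(A)`, `E x` is continuously differentiable on `(0, T]`, and the equation
holds there. -/
structure IsClassicalSolution (E : X →L[ℂ] Z) (A : X →ₗ.[ℂ] Z) (T : ℝ) (δ : ℝ → Z)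
    (x : ℝ → X) : Prop where
  continuousOn : ContinuousOn x (Icc 0 T)
  contDiffOn : ContDiffOn ℝ 1 (fun t => E (x t)) (Ioc 0 T)
  mem_domain : ∀ t ∈ Icc 0 T, x t ∈ A.domain
  equation : ∀ t ∈ Ioc 0 T, ∃ h : x t ∈ A.domain,
    HasDerivWithinAt (fun s => E (x s)) (A ⟨x t, h⟩ + δ t) (Ioc 0 T) t

/-- The size of a perturbation: `∑_{i < p} max_{[0, T]} ‖δ⁽ⁱ⁾‖` if `p ≥ 1`, and
`∫₀ᵀ ‖δ(t)‖ dt` if `p = 0`. -/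
noncomputable def perturbationSize (T : ℝ) (p : ℕ) (δ : ℝ → Z) : ℝ :=
  if p = 0 then ∫ t in (0 : ℝ)..T, ‖δ t‖
  else ∑ i ∈ Finset.range p, ⨆ t : Icc (0 : ℝ) T, ‖iteratedDerivWithin i δ (Icc 0 T) t‖

/-- There is a constant `c` such that all classical solutions `x` on `[0, T]` belonging to
perturbations `δ ∈ C^{p-1}([0, T]; Z)` (`δ` continuous if `p = 0`) satisfy
`max_{[0, T]} ‖x‖ ≤ c (‖x(0)‖ + perturbationSize T p δ)`. -/
def HasPerturbationEstimate (E : X →L[ℂ] Z) (A : X →ₗ.[ℂ] Z) (T : ℝ) (p : ℕ) : Prop :=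
  ∃ c : ℝ, 0 < c ∧ ∀ (δ : ℝ → Z) (x : ℝ → X),
    ContDiffOn ℝ ((p - 1 : ℕ) : WithTop ℕ∞) δ (Icc 0 T) → IsClassicalSolution E A T δ x →
      ∀ t ∈ Icc 0 T, ‖x t‖ ≤ c * (‖x 0‖ + perturbationSize T p δ)

/-- The perturbation index is the least `p` for which the estimate holds; it is required to be
the same for all time horizons `T > 0`. -/
def IsPerturbationIndex (E : X →L[ℂ] Z) (A : X →ₗ.[ℂ] Z) (p : ℕ) : Prop :=
  ∀ T : ℝ, 0 < T → IsLeast {q | HasPerturbationEstimate E A T q} p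

end Basic

/-! ### Weierstraß form and nilpotency index -/

section Weierstrass

variable {Y₁ : Type w} [NormedAddCommGroup Y₁] [InnerProductSpace ℂ Y₁]
  {Y₂ : Type w} [NormedAddCommGroup Y₂] [InnerProductSpace ℂ Y₂]

/-- `diag(I, N)` on the Hilbert space direct sum `Y₁ ⊕ Y₂`. -/
noncomputable def weierstrassE (Y₁ : Type w) [NormedAddCommGroup Y₁] [InnerProductSpace ℂ Y₁]
    (N : Y₂ →L[ℂ] Y₂) : WithLp 2 (Y₁ × Y₂) →L[ℂ] WithLp 2 (Y₁ × Y₂) :=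
  (WithLp.prodContinuousLinearEquiv 2 ℂ Y₁ Y₂).symm.toContinuousLinearMap.comp
    (((ContinuousLinearMap.id ℂ Y₁).prodMap N).comp
      (WithLp.prodContinuousLinearEquiv 2 ℂ Y₁ Y₂).toContinuousLinearMap)

/-- `diag(A₁, I)` on `Y₁ ⊕ Y₂`, with domain `D(A₁) ⊕ Y₂`. -/
noncomputable def weierstrassA (Y₂ : Type w) [NormedAddCommGroup Y₂] [InnerProductSpace ℂ Y₂]
    (A₁ : Y₁ →ₗ.[ℂ] Y₁) : WithLp 2 (Y₁ × Y₂) →ₗ.[ℂ] WithLp 2 (Y₁ × Y₂) where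
  domain := A₁.domain.comap (WithLp.fstL 2 ℂ Y₁ Y₂ : WithLp 2 (Y₁ × Y₂) →ₗ[ℂ] Y₁)
  toFun :=
    { toFun := fun y => WithLp.toLp 2 (A₁ ⟨y.1.fst, y.2⟩, y.1.snd)
      map_add' := by
        intro y z
        have : A₁ ⟨(y + z).1.fst, (y + z).2⟩ = A₁ ⟨y.1.fst, y.2⟩ + A₁ ⟨z.1.fst, z.2⟩ := by
          rw [← LinearPMap.map_add]; rfl
        rw [this]; rfl
      map_smul' := by
        intro c y
        have : A₁ ⟨(c • y).1.fst, (c • y).2⟩ = c • A₁ ⟨y.1.fst, y.2⟩ := by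
          rw [← LinearPMap.map_smul]; rfl
        rw [this]; rfl }

variable {X : Type u} [NormedAddCommGroup X] [InnerProductSpace ℂ X]
  {Z : Type v} [NormedAddCommGroup Z] [InnerProductSpace ℂ Z]

/-- `(E, A) ∼ (diag(I, N), diag(A₁, I))` on `Y₁ ⊕ Y₂` with `N` nilpotent. -/
def IsWeierstrassForm (E : X →L[ℂ] Z) (A : X →ₗ.[ℂ] Z)
    (N : Y₂ →L[ℂ] Y₂) (A₁ : Y₁ →ₗ.[ℂ] Y₁) : Prop :=
  IsNilpotent N ∧ Equivalent E A (weierstrassE Y₁ N) (weierstrassA Y₂ A₁)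

end Weierstrass

/-- `(E, A)` has a Weierstraß form on Hilbert spaces, and in each of its Weierstraß forms the
least `k` with `N ^ k = 0` is `p` (so `p = 0` if and only if `Y₂ = 0`). -/
def IsNilpotencyIndex {X : Type u} [NormedAddCommGroup X] [InnerProductSpace ℂ X]
    {Z : Type v} [NormedAddCommGroup Z] [InnerProductSpace ℂ Z]
    (E : X →L[ℂ] Z) (A : X →ₗ.[ℂ] Z) (p : ℕ) : Prop :=
  (∃ (Y₁ Y₂ : Type w)
    (_ : NormedAddCommGroup Y₁) (_ : InnerProductSpace ℂ Y₁) (_ : CompleteSpace Y₁)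
    (_ : NormedAddCommGroup Y₂) (_ : InnerProductSpace ℂ Y₂) (_ : CompleteSpace Y₂)
    (N : Y₂ →L[ℂ] Y₂) (A₁ : Y₁ →ₗ.[ℂ] Y₁), IsWeierstrassForm E A N A₁) ∧
  ∀ (Y₁ Y₂ : Type w)
    [NormedAddCommGroup Y₁] [InnerProductSpace ℂ Y₁] [CompleteSpace Y₁]
    [NormedAddCommGroup Y₂] [InnerProductSpace ℂ Y₂] [CompleteSpace Y₂]
    (N : Y₂ →L[ℂ] Y₂) (A₁ : Y₁ →ₗ.[ℂ] Y₁),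
    IsWeierstrassForm E A N A₁ → nilpotencyClass N = p

end DAE

/-!
In a Weierstraß form the pair `(E, A)` is, up to the isomorphisms `P` and `Q`, the direct sum of the
abstract Cauchy problem of `A₁` and of the algebraic problem `N y' = y + f`. Let `p` be the
nilpotency class of `N`. Every upper bound for an index is read off from the two summands, and every
lower bound comes from a chain of maximal length.

*Chains.* A chain has no component in `Y₁`, and its components in `Y₂` form a Jordan chain of `N` for
the eigenvalue zero. Hence the chain index is `p` (`IsSplit.isChainIndex`). As it is defined without
reference to the form, all Weierstraß forms of `(E, A)` have the same nilpotency class, whether or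
not the operators `A₁` in them are generators.

*Lower bounds.* For `q < p` there is a chain `c 0, …, c q` in the domain of `A`
(`IsSplit.exists_isExtendedChain`). The vector `u = ∑ lam ^ (-i) c i`, which tends to `c 0` as
`lam → ∞`, satisfies `(lam E - A) u = - lam ^ (-q) A (c q)`
(`IsExtendedChain.sum_mem_graph`). This identity makes the resolvent grow at least like `lam ^ q`,
and `e ^ (lam (t - T)) u` solves the differential equation with a perturbation whose derivatives of
order less than `q` are small. Moreover `((lam E - A)⁻¹ E) ^ q` maps `c q` to `± c 0` for all `lam`,
which excludes radiality of order `q - 1`. The derivative array of order `q` determines `x'` exactly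
if there is no chain of length `q + 1` (`determinesDerivative_iff_not_hasChainOfLength`).

*Upper bounds.* On `Y₁` they are the Hille–Yosida estimates and the variation of constants formula.
The resolvent of a generator is the Laplace transform of the semigroup, and an exponential bound for
the orbit of `y` passes, with a factor `1 / (lam - ω)`, to the orbit of its transform
(`IsC0Semigroup.norm_apply_laplace_le`); iterating this bounds products of resolvents at different
points. On `Y₂`, `(lam N - I)⁻¹` is the finite sum `- ∑ lam ^ k N ^ k` over `k < p`, products of `p`
operators `(lam N - I)⁻¹ N` vanish, and the solution of `(N b)' = b + h` is `- ∑ N ^ k h⁽ᵏ⁾`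
(`pow_apply_eq_neg_sum`).
-/

namespace DAE

/-! ### Strongly continuous semigroups -/

section Semigroup

variable {Y : Type w} [NormedAddCommGroup Y] [InnerProductSpace ℂ Y]

/-- `T` is a `C₀`-semigroup on `Y`; only its values on `[0, ∞)` matter. -/
structure IsC0Semigroup (T : ℝ → Y →L[ℂ] Y) : Prop where
  zero : T 0 = ContinuousLinearMap.id ℂ Y
  add : ∀ s t, 0 ≤ s → 0 ≤ t → T (s + t) = (T s).comp (T t)
  continuousOn : ∀ x, ContinuousOn (fun t => T t x) (Ici 0)

/-- `A` is the generator of `T`. -/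
def IsGenerator (T : ℝ → Y →L[ℂ] Y) (A : Y →ₗ.[ℂ] Y) : Prop :=
  ∀ x y, (x, y) ∈ A.graph ↔ Tendsto (fun t : ℝ => t⁻¹ • (T t x - x)) (𝓝[>] 0) (𝓝 y)

/-- `‖T t‖ ≤ M e ^ (ω t)` on `[0, ∞)`. -/
def HasGrowthBound (T : ℝ → Y →L[ℂ] Y) (M ω : ℝ) : Prop :=
  ∀ t, 0 ≤ t → ‖T t‖ ≤ M * Real.exp (ω * t)

variable {T : ℝ → Y →L[ℂ] Y} {A : Y →ₗ.[ℂ] Y} {M ω : ℝ}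

/-- The uniform boundedness principle bounds the semigroup on `[0, 1]`, and the functional
equation turns this into an exponential bound on `[0, ∞)`. -/
theorem IsC0Semigroup.exists_growthBound [CompleteSpace Y] (hT : IsC0Semigroup T) :
    ∃ M ω : ℝ, 1 ≤ M ∧ 0 < ω ∧ HasGrowthBound T M ω := by
  obtain ⟨C, hC⟩ := banach_steinhaus (g := fun t : Icc (0 : ℝ) 1 => T t) (fun x => by
    obtain ⟨C, hC⟩ := isCompact_Icc.exists_bound_of_continuousOn
      ((hT.continuousOn x).mono (Icc_subset_Ici_self : Icc (0 : ℝ) 1 ⊆ Ici 0))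
    exact ⟨C, fun t => hC t t.2⟩)
  set M := max C 1 with hM
  have hM1 : 1 ≤ M := le_max_right _ _
  have hTM : ∀ t, 0 ≤ t → t ≤ 1 → ‖T t‖ ≤ M := fun t h0 h1 =>
    (hC ⟨t, h0, h1⟩).trans (le_max_left _ _)
  have hn : ∀ n : ℕ, ‖T n‖ ≤ M ^ n := by
    intro n
    induction n with
    | zero =>
      rw [Nat.cast_zero, hT.zero, pow_zero]
      exact ContinuousLinearMap.norm_id_le
    | succ n ih =>
      rw [Nat.cast_succ, hT.add _ _ n.cast_nonneg zero_le_one, pow_succ]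
      exact (ContinuousLinearMap.opNorm_comp_le _ _).trans
        (mul_le_mul ih (hTM 1 zero_le_one le_rfl) (norm_nonneg _) (by positivity))
  refine ⟨M, Real.log M + 1, hM1, by linarith [Real.log_nonneg hM1], fun t ht => ?_⟩
  have hfl := Nat.floor_le ht
  have hdec : T t = (T (t - ⌊t⌋₊)).comp (T ⌊t⌋₊) := by
    rw [← hT.add _ _ (by linarith) (Nat.cast_nonneg _), sub_add_cancel]
  have hpow : M ^ ⌊t⌋₊ ≤ Real.exp ((Real.log M + 1) * t) := by
    rw [← Real.exp_log (show 0 < M by linarith), ← Real.exp_nat_mul, Real.log_exp]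
    apply Real.exp_le_exp.2
    nlinarith [Real.log_nonneg hM1]
  rw [hdec]
  exact (ContinuousLinearMap.opNorm_comp_le _ _).trans
    (mul_le_mul (hTM _ (by linarith) (by linarith [Nat.lt_floor_add_one t]))
      ((hn _).trans hpow) (norm_nonneg _) (by linarith))

/-- Joint continuity of `(t, y) ↦ T t y`. -/
theorem IsC0Semigroup.tendsto_apply (hT : IsC0Semigroup T) (hM : HasGrowthBound T M ω)
    {ι : Type*} {l : Filter ι} {s : ι → ℝ} {t : ℝ} {y : ι → Y} {z : Y} (ht : 0 ≤ t)
    (hs : Tendsto s l (𝓝[Ici 0] t)) (hy : Tendsto y l (𝓝 z)) :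
    Tendsto (fun i => T (s i) (y i)) l (𝓝 (T t z)) := by
  have h1 : Tendsto (fun i => T (s i) z) l (𝓝 (T t z)) :=
    (hT.continuousOn z t ht).tendsto.comp hs
  have hsn : Tendsto s l (𝓝 t) := hs.mono_right nhdsWithin_le_nhds
  have h2 : Tendsto (fun i => T (s i) (y i - z)) l (𝓝 0) := by
    have hb : Tendsto (fun i => M * Real.exp (ω * s i) * ‖y i - z‖) l (𝓝 0) := by
      have h3 : Tendsto (fun i => M * Real.exp (ω * s i)) l (𝓝 (M * Real.exp (ω * t))) :=
        ((Real.continuous_exp.tendsto _).comp (hsn.const_mul ω)).const_mul M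
      have h4 : Tendsto (fun i => ‖y i - z‖) l (𝓝 0) := tendsto_iff_norm_sub_tendsto_zero.1 hy
      simpa using h3.mul h4
    refine squeeze_zero_norm' ?_ hb
    filter_upwards [hs.eventually eventually_mem_nhdsWithin] with i hi
    exact (ContinuousLinearMap.le_opNorm _ _).trans
      (mul_le_mul_of_nonneg_right (hM _ hi) (norm_nonneg _))
  simpa using h1.add h2

/-- A continuous curve in `[0, ∞)` applied through `T` to a continuous curve is continuous. -/
theorem IsC0Semigroup.continuousOn_apply (hT : IsC0Semigroup T) (hM : HasGrowthBound T M ω)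
    {s : ℝ → ℝ} {y : ℝ → Y} {S : Set ℝ} (hs : ContinuousOn s S) (h0 : ∀ t ∈ S, 0 ≤ s t)
    (hy : ContinuousOn y S) : ContinuousOn (fun t => T (s t) (y t)) S := fun t ht =>
  hT.tendsto_apply hM (h0 t ht)
    (tendsto_nhdsWithin_iff.2 ⟨hs t ht, eventually_mem_nhdsWithin.mono h0⟩) (hy t ht)

/-- The derivative of `s ↦ T (t - s) (a s)` from the right, where `a s` lies in the domain of the
generator. -/
theorem IsC0Semigroup.hasDerivWithinAt_comp_sub (hT : IsC0Semigroup T)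
    (hM : HasGrowthBound T M ω) (hA : IsGenerator T A) {a : ℝ → Y} {a' y : Y} {s t : ℝ}
    (hst : s < t) (ha : HasDerivWithinAt a a' (Ioi s) s) (hy : (a s, y) ∈ A.graph) :
    HasDerivWithinAt (fun r => T (t - r) (a r)) (T (t - s) (a' - y)) (Ioi s) s := by
  rw [hasDerivWithinAt_iff_tendsto_slope' self_notMem_Ioi] at ha ⊢
  have hshift : Tendsto (fun r => r - s) (𝓝[>] s) (𝓝[>] 0) := by
    refine tendsto_nhdsWithin_iff.2 ⟨?_, ?_⟩
    · have : Tendsto (fun r => r - s) (𝓝 s) (𝓝 (s - s)) := tendsto_id.sub_const s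
      rw [sub_self] at this
      exact this.mono_left nhdsWithin_le_nhds
    · filter_upwards [self_mem_nhdsWithin] with r hr
      exact sub_pos.2 (mem_Ioi.1 hr)
  have hgen := ((hA _ _).1 hy).comp hshift
  have hdiff := ha.sub hgen
  have harg : Tendsto (fun r => t - r) (𝓝[>] s) (𝓝[Ici 0] (t - s)) := by
    refine tendsto_nhdsWithin_iff.2
      ⟨(tendsto_id.const_sub t).mono_left nhdsWithin_le_nhds, ?_⟩
    filter_upwards [mem_nhdsWithin_of_mem_nhds (Iio_mem_nhds hst)] with r hr
    exact sub_nonneg.2 (mem_Iio.1 hr).le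
  -- the difference quotient is `T (t - r)` applied to the difference of those of `a` and of the
  -- orbit of `a s`, so joint continuity of `T` gives the limit
  refine (hT.tendsto_apply hM (sub_nonneg.2 hst.le) harg hdiff).congr' ?_
  filter_upwards [self_mem_nhdsWithin, mem_nhdsWithin_of_mem_nhds (Iio_mem_nhds hst)] with r hr hrt
  have hr0 : 0 ≤ r - s := sub_nonneg.2 (le_of_lt hr)
  have hsplit : T (t - s) (a s) = T (t - r) (T (r - s) (a s)) := by
    rw [← ContinuousLinearMap.comp_apply, ← hT.add _ _ (sub_nonneg.2 (le_of_lt hrt)) hr0]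
    congr 2
    ring
  simp only [Function.comp, slope_def_module, hsplit, ← smul_sub]
  rw [show a r - a s - (T (r - s) (a s) - a s) = a r - T (r - s) (a s) by abel,
    ContinuousLinearMap.map_smul_of_tower, map_sub]

/-- Variation of constants for a curve that satisfies `a' = A a + g` on an open interval. -/
theorem IsC0Semigroup.eq_add_integral [CompleteSpace Y] (hT : IsC0Semigroup T)
    (hM : HasGrowthBound T M ω) (hA : IsGenerator T A) {a b g : ℝ → Y} {t : ℝ} (ht : 0 ≤ t)
    (ha : ContinuousOn a (Icc 0 t)) (hg : ContinuousOn g (Icc 0 t))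
    (hgraph : ∀ s ∈ Ioo 0 t, (a s, b s) ∈ A.graph)
    (hderiv : ∀ s ∈ Ioo 0 t, HasDerivWithinAt a (b s + g s) (Ioi s) s) :
    a t = T t (a 0) + ∫ s in (0 : ℝ)..t, T (t - s) (g s) := by
  have hsub : ContinuousOn (fun s => t - s) (Icc 0 t) := by fun_prop
  have hsub0 : ∀ s ∈ Icc 0 t, 0 ≤ t - s := fun s hs => sub_nonneg.2 hs.2
  have hcont := hT.continuousOn_apply hM hsub hsub0 ha
  have hint := hT.continuousOn_apply hM hsub hsub0 hg
  have h := intervalIntegral.integral_eq_sub_of_hasDeriv_right_of_le ht hcont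
    (f' := fun s => T (t - s) (g s)) (fun s hs => by
      have := hT.hasDerivWithinAt_comp_sub hM hA hs.2 (hderiv s hs) (hgraph s hs)
      rwa [add_sub_cancel_left] at this)
    (hint.intervalIntegrable_of_Icc ht)
  rw [h, sub_self, hT.zero, sub_zero]
  simp

theorem IsC0Semigroup.norm_le_of_ode [CompleteSpace Y] (hT : IsC0Semigroup T)
    (hM : HasGrowthBound T M ω) (hA : IsGenerator T A) (hω : 0 ≤ ω) (hM0 : 0 ≤ M)
    {a b g : ℝ → Y} {t τ : ℝ} (ht : 0 ≤ t) (htτ : t ≤ τ)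
    (ha : ContinuousOn a (Icc 0 t)) (hg : ContinuousOn g (Icc 0 τ))
    (hgraph : ∀ s ∈ Ioo 0 t, (a s, b s) ∈ A.graph)
    (hderiv : ∀ s ∈ Ioo 0 t, HasDerivWithinAt a (b s + g s) (Ioi s) s) :
    ‖a t‖ ≤ M * Real.exp (ω * τ) * (‖a 0‖ + ∫ s in (0 : ℝ)..τ, ‖g s‖) := by
  have hgt : ContinuousOn g (Icc 0 t) := hg.mono (Icc_subset_Icc_right htτ)
  have hTb : ∀ s, 0 ≤ s → s ≤ t → ‖T s‖ ≤ M * Real.exp (ω * τ) := fun s h0 h1 =>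
    (hM s h0).trans (mul_le_mul_of_nonneg_left
      (Real.exp_le_exp.2 (mul_le_mul_of_nonneg_left (h1.trans htτ) hω)) hM0)
  have hint : ‖∫ s in (0 : ℝ)..t, T (t - s) (g s)‖
      ≤ M * Real.exp (ω * τ) * ∫ s in (0 : ℝ)..τ, ‖g s‖ := by
    calc _ ≤ ∫ s in (0 : ℝ)..t, M * Real.exp (ω * τ) * ‖g s‖ := by
          refine intervalIntegral.norm_integral_le_of_norm_le ht ?_
            ((hgt.norm.intervalIntegrable_of_Icc ht).const_mul _)
          filter_upwards with s hs
          exact (ContinuousLinearMap.le_opNorm _ _).trans (mul_le_mul_of_nonneg_right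
            (hTb _ (sub_nonneg.2 hs.2) (by linarith [hs.1])) (norm_nonneg _))
      _ = M * Real.exp (ω * τ) * ∫ s in (0 : ℝ)..t, ‖g s‖ := by
          rw [intervalIntegral.integral_const_mul]
      _ ≤ _ := by
          refine mul_le_mul_of_nonneg_left ?_ (by positivity)
          exact intervalIntegral.integral_mono_interval le_rfl ht htτ
            (Eventually.of_forall fun s => norm_nonneg _)
            (hg.norm.intervalIntegrable_of_Icc (ht.trans htτ))
  rw [hT.eq_add_integral hM hA ht ha hgt hgraph hderiv, mul_add]
  refine (norm_add_le _ _).trans (add_le_add ?_ hint)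
  exact (ContinuousLinearMap.le_opNorm _ _).trans
    (mul_le_mul_of_nonneg_right (hTb t ht le_rfl) (norm_nonneg _))

/-! ### The resolvent of a generator -/

/-- `lam - A` is injective for `lam > ω`: an eigenvector `x` would give `T t x = e ^ (lam t) x`,
which violates the growth bound. -/
theorem IsC0Semigroup.eq_zero_of_eigenvector [CompleteSpace Y] (hT : IsC0Semigroup T)
    (hM : HasGrowthBound T M ω) (hA : IsGenerator T A) {lam : ℝ} (hlam : ω < lam) {x : Y}
    (hx : (x, lam • x) ∈ A.graph) : x = 0 := by
  have hgraph : ∀ s : ℝ, (Real.exp (lam * s) • x, Real.exp (lam * s) • lam • x) ∈ A.graph :=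
    fun s => A.graph.smul_of_tower_mem (Real.exp (lam * s)) hx
  have horb : ∀ t, 0 ≤ t → Real.exp (lam * t) • x = T t x := by
    intro t ht
    have hc : Continuous fun s : ℝ => Real.exp (lam * s) • x := by fun_prop
    have := hT.eq_add_integral hM hA (a := fun s => Real.exp (lam * s) • x) (g := fun _ => 0)
      ht hc.continuousOn continuousOn_const (fun s _ => hgraph s) (fun s _ => by
        have h1 : HasDerivAt (fun s : ℝ => Real.exp (lam * s)) (Real.exp (lam * s) * lam) s := by
          simpa using ((hasDerivAt_id s).const_mul lam).exp
        simpa [mul_smul] using (h1.smul_const x).hasDerivWithinAt)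
    simpa using this
  have hlim : Tendsto (fun t : ℝ => M * Real.exp (-((lam - ω) * t)) * ‖x‖) atTop (𝓝 0) := by
    have h1 : Tendsto (fun t : ℝ => (lam - ω) * t) atTop atTop :=
      tendsto_id.const_mul_atTop (sub_pos.2 hlam)
    have h2 := (Real.tendsto_exp_neg_atTop_nhds_zero.comp h1)
    simpa using (h2.const_mul M).mul_const ‖x‖
  have : ‖x‖ ≤ 0 := by
    refine ge_of_tendsto hlim ?_
    filter_upwards [eventually_ge_atTop 0] with t ht
    have h1 : Real.exp (lam * t) * ‖x‖ ≤ M * Real.exp (ω * t) * ‖x‖ := by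
      have := (T t).le_of_opNorm_le (hM t ht) x
      rwa [← horb t ht, norm_smul, Real.norm_of_nonneg (Real.exp_pos _).le] at this
    have h2 : Real.exp (-((lam - ω) * t)) = Real.exp (ω * t) / Real.exp (lam * t) := by
      rw [← Real.exp_sub]; ring_nf
    rw [h2, ← mul_div_assoc, div_mul_eq_mul_div, le_div_iff₀ (Real.exp_pos _)]
    linarith
  exact norm_le_zero_iff.1 this

theorem IsC0Semigroup.integrableOn_exp_smul (hT : IsC0Semigroup T) (hM : HasGrowthBound T M ω)
    {lam : ℝ} (hlam : ω < lam) (y : Y) :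
    MeasureTheory.IntegrableOn (fun t => Real.exp (-lam * t) • T t y) (Ioi 0) := by
  have hdom : MeasureTheory.IntegrableOn (fun t => Real.exp ((ω - lam) * t) * (M * ‖y‖)) (Ioi 0) :=
    (integrableOn_exp_mul_Ioi (sub_neg.2 hlam) 0).mul_const _
  have hc : ContinuousOn (fun t => Real.exp (-lam * t) • T t y) (Ioi 0) :=
    (by fun_prop : Continuous fun t : ℝ => Real.exp (-lam * t)).continuousOn.smul
      ((hT.continuousOn y).mono Ioi_subset_Ici_self)
  refine MeasureTheory.Integrable.mono' hdom (hc.aestronglyMeasurable measurableSet_Ioi) ?_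
  filter_upwards [MeasureTheory.ae_restrict_mem measurableSet_Ioi] with t ht
  rw [norm_smul, Real.norm_of_nonneg (Real.exp_pos _).le, sub_mul, sub_eq_neg_add, ← neg_mul,
    Real.exp_add, mul_assoc]
  refine mul_le_mul_of_nonneg_left ?_ (Real.exp_pos _).le
  refine ((T t).le_of_opNorm_le (hM t (mem_Ioi.1 ht).le) y).trans_eq ?_
  ring

/-- The Laplace transform `∫₀^∞ e ^ (-lam t) T t y dt` of an orbit. -/
noncomputable def laplace (T : ℝ → Y →L[ℂ] Y) (lam : ℝ) (y : Y) : Y :=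
  ∫ t in Ioi (0 : ℝ), Real.exp (-lam * t) • T t y

theorem IsC0Semigroup.apply_laplace [CompleteSpace Y] (hT : IsC0Semigroup T)
    (hM : HasGrowthBound T M ω) {lam : ℝ} (hlam : ω < lam) (y : Y) {s : ℝ} (hs : 0 ≤ s) :
    T s (laplace T lam y) = ∫ t in Ioi (0 : ℝ), Real.exp (-lam * t) • T (s + t) y := by
  rw [laplace, ← ContinuousLinearMap.integral_comp_comm _ (hT.integrableOn_exp_smul hM hlam y)]
  refine MeasureTheory.setIntegral_congr_fun measurableSet_Ioi fun t ht => ?_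
  rw [hT.add s t hs (mem_Ioi.1 ht).le, ContinuousLinearMap.map_smul_of_tower]
  rfl

/-- An exponential bound with constant `K` on the orbit of `y` passes to the Laplace transform
with constant `K / (lam - ω)`. Stated for whole orbits, the estimate can be iterated without
loss. -/
theorem IsC0Semigroup.norm_apply_laplace_le [CompleteSpace Y] (hT : IsC0Semigroup T)
    (hM : HasGrowthBound T M ω) {lam : ℝ} (hlam : ω < lam) {y : Y} {K : ℝ}
    (hK : ∀ s, 0 ≤ s → ‖T s y‖ ≤ K * Real.exp (ω * s)) {s : ℝ} (hs : 0 ≤ s) :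
    ‖T s (laplace T lam y)‖ ≤ K / (lam - ω) * Real.exp (ω * s) := by
  rw [hT.apply_laplace hM hlam y hs]
  have hI : MeasureTheory.IntegrableOn
      (fun t => Real.exp ((ω - lam) * t) * (K * Real.exp (ω * s))) (Ioi 0) :=
    (integrableOn_exp_mul_Ioi (sub_neg.2 hlam) 0).mul_const _
  refine (MeasureTheory.norm_integral_le_of_norm_le hI ?_).trans_eq ?_
  · filter_upwards [MeasureTheory.ae_restrict_mem measurableSet_Ioi] with t ht
    rw [norm_smul, Real.norm_of_nonneg (Real.exp_pos _).le]
    refine (mul_le_mul_of_nonneg_left (hK (s + t) (add_nonneg hs (mem_Ioi.1 ht).le))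
      (Real.exp_pos _).le).trans_eq ?_
    rw [mul_add, Real.exp_add, sub_mul, sub_eq_neg_add, ← neg_mul, Real.exp_add]
    ring
  · rw [MeasureTheory.integral_mul_const, integral_exp_mul_Ioi (sub_neg.2 hlam)]
    have h1 : ω - lam ≠ 0 := (sub_neg.2 hlam).ne
    have h2 : lam - ω ≠ 0 := (sub_pos.2 hlam).ne'
    rw [mul_zero, Real.exp_zero, ← neg_sub lam ω]
    field_simp

theorem IsC0Semigroup.laplace_mem_graph [CompleteSpace Y] (hT : IsC0Semigroup T)
    (hM : HasGrowthBound T M ω) (hA : IsGenerator T A) {lam : ℝ} (hlam : ω < lam) (y : Y) :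
    (laplace T lam y, lam • laplace T lam y - y) ∈ A.graph := by
  set F : ℝ → Y := fun t => Real.exp (-lam * t) • T t y with hF
  have hFc : ContinuousOn F (Ici 0) :=
    (by fun_prop : Continuous fun t : ℝ => Real.exp (-lam * t)).continuousOn.smul
      (hT.continuousOn y)
  have hFi : MeasureTheory.IntegrableOn F (Ioi 0) := hT.integrableOn_exp_smul hM hlam y
  -- shifting the integration variable expresses `T h` on the transform by an integral over `[0, h]`
  have hshift : ∀ h, 0 ≤ h →
      T h (laplace T lam y) = Real.exp (lam * h) • (laplace T lam y - ∫ t in (0 : ℝ)..h, F t) := by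
    intro h hh
    have h1 : (∫ t in (0 : ℝ)..h, F t) + ∫ t in Ioi h, F t = laplace T lam y :=
      intervalIntegral.integral_interval_add_Ioi hFi (hFi.mono_set (Ioi_subset_Ioi hh))
    have h2 : ∫ t in Ioi h, F t = ∫ t in Ioi (0 : ℝ), F (h + t) := by
      have := MeasureTheory.MeasurePreserving.setIntegral_preimage_emb
        (MeasureTheory.measurePreserving_add_left MeasureTheory.volume h)
        (measurableEmbedding_addLeft h) F (Ioi h)
      rw [← this]
      congr 2
      ext t
      simp
    rw [hT.apply_laplace hM hlam y hh, ← h1, add_sub_cancel_left, h2,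
      ← MeasureTheory.integral_smul]
    refine MeasureTheory.setIntegral_congr_fun measurableSet_Ioi fun t _ => ?_
    simp only [hF, smul_smul, ← Real.exp_add]
    congr 2
    ring
  have hder : HasDerivWithinAt (fun h => ∫ t in (0 : ℝ)..h, F t) (F 0) (Ici 0) 0 :=
    intervalIntegral.integral_hasDerivWithinAt_right (t := Ioi 0) (by simp)
      ⟨Ioi 0, self_mem_nhdsWithin,
        (hFc.mono Ioi_subset_Ici_self).aestronglyMeasurable measurableSet_Ioi⟩
      ((hFc 0 self_mem_Ici).mono Ioi_subset_Ici_self)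
  have hexp : HasDerivWithinAt (fun h : ℝ => Real.exp (lam * h)) lam (Ici 0) 0 := by
    have : HasDerivAt (fun h : ℝ => Real.exp (lam * h)) (Real.exp (lam * 0) * (lam * 1)) 0 :=
      ((hasDerivAt_id (0 : ℝ)).const_mul lam).exp
    simpa using this.hasDerivWithinAt
  have hψ := (hexp.smul (hder.const_sub (laplace T lam y))).mono Ioi_subset_Ici_self
  rw [hasDerivWithinAt_iff_tendsto_slope' self_notMem_Ioi] at hψ
  rw [hA]
  have hF0 : F 0 = y := by simp [hF, hT.zero]
  convert hψ.congr' ?_ using 2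
  · simp [hF0, sub_eq_neg_add]
  · filter_upwards [self_mem_nhdsWithin] with h hh
    rw [slope_def_module, hshift h (mem_Ioi.1 hh).le]
    simp

/-- The resolvents of a generator exist to the right of the growth bound. The second property is
the orbit-wise form of the Hille–Yosida estimates. -/
theorem IsC0Semigroup.exists_resolvent [CompleteSpace Y] (hT : IsC0Semigroup T)
    (hM : HasGrowthBound T M ω) (hA : IsGenerator T A) {lam : ℝ} (hlam : ω < lam) :
    ∃ R : Y →L[ℂ] Y, (∀ y, (R y, lam • R y - y) ∈ A.graph) ∧
      (∀ x y, (x, y) ∈ A.graph → R (lam • x - y) = x) ∧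
      ∀ (y : Y) (K : ℝ), (∀ s, 0 ≤ s → ‖T s y‖ ≤ K * Real.exp (ω * s)) →
        ∀ s, 0 ≤ s → ‖T s (R y)‖ ≤ K / (lam - ω) * Real.exp (ω * s) := by
  let R : Y →L[ℂ] Y := LinearMap.mkContinuous
    { toFun := laplace T lam
      map_add' := fun x y => by
        rw [laplace, laplace, laplace, ← MeasureTheory.integral_add
          (hT.integrableOn_exp_smul hM hlam x) (hT.integrableOn_exp_smul hM hlam y)]
        simp
      map_smul' := fun c x => by
        rw [laplace, laplace, RingHom.id_apply, ← MeasureTheory.integral_smul]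
        refine MeasureTheory.setIntegral_congr_fun measurableSet_Ioi fun t _ => ?_
        simp only [map_smul]
        exact smul_comm _ _ _ } (M / (lam - ω)) (fun y => by
      have := hT.norm_apply_laplace_le hM hlam (y := y) (K := M * ‖y‖) (fun s hs => by
        refine ((T s).le_of_opNorm_le (hM s hs) y).trans_eq ?_
        ring) le_rfl
      rw [hT.zero, mul_zero, Real.exp_zero, mul_one, mul_div_right_comm] at this
      exact this)
  have hR : ∀ y, (R y, lam • R y - y) ∈ A.graph := hT.laplace_mem_graph hM hA hlam
  refine ⟨R, hR, fun x y hxy => ?_, fun y K hK s hs => hT.norm_apply_laplace_le hM hlam hK hs⟩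
  have h := A.graph.sub_mem (hR (lam • x - y)) hxy
  refine sub_eq_zero.1 (hT.eq_zero_of_eigenvector hM hA hlam ?_)
  convert h using 1
  simp only [Prod.mk_sub_mk, Prod.mk.injEq, true_and, smul_sub]
  abel

/-- The Hille–Yosida estimate for products of resolvents at possibly different points. -/
theorem IsC0Semigroup.norm_prod_resolvent_le (hT : IsC0Semigroup T)
    (hM : HasGrowthBound T M ω) (hM0 : 0 ≤ M) {R : ℝ → Y →L[ℂ] Y}
    (hR : ∀ lam, ω < lam → ∀ (y : Y) (K : ℝ), (∀ s, 0 ≤ s → ‖T s y‖ ≤ K * Real.exp (ω * s)) →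
        ∀ s, 0 ≤ s → ‖T s (R lam y)‖ ≤ K / (lam - ω) * Real.exp (ω * s))
    {n : ℕ} (l : Fin n → ℝ) (hl : ∀ k, ω < l k) :
    ‖(List.ofFn fun k => R (l k)).prod‖ ≤ M / ∏ k, (l k - ω) := by
  have key : ∀ (y : Y) s, 0 ≤ s → ‖T s ((List.ofFn fun k => R (l k)).prod y)‖
      ≤ M * ‖y‖ / (∏ k, (l k - ω)) * Real.exp (ω * s) := by
    intro y
    induction n with
    | zero =>
      intro s hs
      simp only [List.ofFn_zero, List.prod_nil, Finset.univ_eq_empty, Finset.prod_empty, div_one]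
      refine ((T s).le_of_opNorm_le (hM s hs) y).trans_eq ?_
      ring
    | succ n ih =>
      intro s hs
      rw [List.ofFn_succ, List.prod_cons, Fin.prod_univ_succ, mul_comm (l 0 - ω), ← div_div]
      exact hR (l 0) (hl 0) _ _ (ih (fun k => l k.succ) fun k => hl k.succ) s hs
  refine ContinuousLinearMap.opNorm_le_bound _
    (div_nonneg hM0 (Finset.prod_nonneg fun k _ => (sub_pos.2 (hl k)).le)) fun y => ?_
  have := key y 0 le_rfl
  rwa [hT.zero, mul_zero, Real.exp_zero, mul_one, mul_div_right_comm] at this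

end Semigroup
/-! ### Chains and lower bounds for the indices -/

section Chain

variable {X : Type u} [NormedAddCommGroup X] [InnerProductSpace ℂ X]
  {Z : Type v} [NormedAddCommGroup Z] [InnerProductSpace ℂ Z]
  {E : X →L[ℂ] Z} {A : X →ₗ.[ℂ] Z}

theorem mem_graph_iff_exists {x : X} {z : Z} :
    (x, z) ∈ A.graph ↔ ∃ h : x ∈ A.domain, A ⟨x, h⟩ = z := by
  rw [LinearPMap.mem_graph_iff]
  constructor
  · rintro ⟨y, rfl, rfl⟩
    exact ⟨y.2, rfl⟩
  · rintro ⟨h, rfl⟩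
    exact ⟨⟨x, h⟩, rfl, rfl⟩

theorem isResolventAt_iff_graph {lam : ℂ} {R : Z →L[ℂ] X} :
    IsResolventAt E A lam R ↔ (∀ z, (R z, lam • E (R z) - z) ∈ A.graph) ∧
      ∀ x z, (x, z) ∈ A.graph → R (lam • E x - z) = x := by
  simp only [IsResolventAt, mem_graph_iff_exists]
  refine and_congr (forall_congr' fun z => exists_congr fun h => ?_) ⟨?_, fun h x => ?_⟩
  · rw [sub_eq_iff_eq_add, eq_sub_iff_add_eq, eq_comm, add_comm]
  · rintro h x z ⟨hx, rfl⟩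
    exact h ⟨x, hx⟩
  · exact h x _ ⟨x.2, rfl⟩

/-- A chain `c 0, …, c q` of length `q + 1` whose last element is in the domain of `A` as well,
with `A (c q) = w`. -/
structure IsExtendedChain (E : X →L[ℂ] Z) (A : X →ₗ.[ℂ] Z) (q : ℕ) (c : ℕ → X) (w : Z) :
    Prop where
  ne_zero : c 0 ≠ 0
  ker : E (c 0) = 0
  step : ∀ i < q, (c i, E (c (i + 1))) ∈ A.graph
  last : (c q, w) ∈ A.graph

theorem determinesDerivative_iff_not_hasChainOfLength {q : ℕ} :
    DeterminesDerivative E A q ↔ ¬ HasChainOfLength E A (q + 1) := by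
  constructor
  · rintro h ⟨-, c, hc0, hker, hstep⟩
    -- prepend a zero to the chain and compare with the zero solution
    have hx : DerivativeArray E A q (fun i => Nat.casesOn i 0 c) (fun _ => 0) := by
      rintro (_ | i) hi
      · refine ⟨A.domain.zero_mem, ?_⟩
        change E (c 0) = A 0 + 0
        rw [A.map_zero, add_zero, hker]
      · obtain ⟨h, he⟩ := hstep i (by omega)
        exact ⟨h, by simpa using he⟩
    have hy : DerivativeArray E A q (fun _ => 0) (fun _ => 0) := fun i _ => by
      refine ⟨A.domain.zero_mem, ?_⟩
      change E 0 = A 0 + 0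
      rw [A.map_zero, add_zero, map_zero]
    exact hc0 (h _ _ _ hx hy rfl)
  · intro h x y f hx hy h0
    by_contra hne
    have hd : ∀ i ≤ q, (x i - y i, E (x (i + 1) - y (i + 1))) ∈ A.graph := by
      intro i hi
      obtain ⟨h1, e1⟩ := hx i hi
      obtain ⟨h2, e2⟩ := hy i hi
      have := A.graph.sub_mem (A.mem_graph ⟨_, h1⟩) (A.mem_graph ⟨_, h2⟩)
      rwa [Prod.mk_sub_mk, ← add_sub_add_right_eq_sub _ _ (f i), ← e1, ← e2, ← map_sub] at this
    refine h ⟨Nat.succ_pos q, fun i => x (i + 1) - y (i + 1), sub_ne_zero.2 hne, ?_, ?_⟩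
    · have := hd 0 q.zero_le
      rw [h0, sub_self, mem_graph_iff_exists] at this
      obtain ⟨h, e⟩ := this
      rw [← e]
      exact A.map_zero
    · intro i hi
      obtain ⟨h, e⟩ := mem_graph_iff_exists.1 (hd (i + 1) (by omega))
      exact ⟨h, e.symm⟩

namespace IsExtendedChain

variable {q : ℕ} {c : ℕ → X} {w : Z}

/-- For a chain `c 0, …, c q` and `u = ∑ lam ^ (-i) c i` one has
`A u = lam E u + lam ^ (-q) A (c q)`: up to a small error, `u` is an eigenvector at `lam`. -/
theorem sum_mem_graph (h : IsExtendedChain E A q c w) {lam : ℂ} (hlam : lam ≠ 0) :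
    (∑ i ∈ Finset.range (q + 1), lam⁻¹ ^ i • c i,
      lam • E (∑ i ∈ Finset.range (q + 1), lam⁻¹ ^ i • c i) + lam⁻¹ ^ q • w) ∈ A.graph := by
  have hsum := A.graph.add_mem
    (A.graph.sum_mem fun i (hi : i ∈ Finset.range q) =>
      A.graph.smul_mem (lam⁻¹ ^ i) (h.step i (Finset.mem_range.1 hi)))
    (A.graph.smul_mem (lam⁻¹ ^ q) h.last)
  convert hsum using 1
  ext1
  · simp [Prod.fst_sum, Finset.sum_range_succ]
  · rw [Finset.sum_range_succ', map_add, map_smul _ _ (c 0), h.ker, smul_zero, add_zero, map_sum,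
      Finset.smul_sum]
    simp only [Prod.snd_add, Prod.snd_sum, Prod.smul_snd, map_smul, smul_smul]
    congr 1
    refine Finset.sum_congr rfl fun i _ => ?_
    rw [pow_succ', mul_inv_cancel_left₀ hlam]

theorem tendsto_sum (c : ℕ → X) (q : ℕ) :
    Tendsto (fun m : ℝ => ∑ i ∈ Finset.range (q + 1), (m : ℂ)⁻¹ ^ i • c i) atTop (𝓝 (c 0)) := by
  have hcont : Continuous fun z : ℂ => ∑ i ∈ Finset.range (q + 1), z ^ i • c i := by fun_prop
  have hinv : Tendsto (fun m : ℝ => (m : ℂ)⁻¹) atTop (𝓝 0) := by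
    have := (Complex.continuous_ofReal.tendsto 0).comp tendsto_inv_atTop_zero
    simpa [Function.comp_def] using this
  have := (hcont.tendsto 0).comp hinv
  simpa [Function.comp_def, Finset.sum_range_succ'] using this

/-- A chain of length `q + 1` forces the resolvent to grow faster than `lam ^ (q - 1)`. -/
theorem not_hasResolventBound (h : IsExtendedChain E A q c w) : ¬ HasResolventBound E A q := by
  rintro ⟨ω, C, hC, hb⟩
  have hlim : Tendsto (fun m : ℝ => C * ‖w‖ * m⁻¹) atTop (𝓝 0) := by
    simpa using tendsto_inv_atTop_zero.const_mul (C * ‖w‖)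
  refine h.ne_zero (norm_le_zero_iff.1 (le_of_tendsto_of_tendsto (tendsto_sum c q).norm hlim ?_))
  filter_upwards [eventually_gt_atTop ω, eventually_gt_atTop 0] with m hm hm0
  obtain ⟨hmem, hnorm⟩ := hb m hm
  have hmC : (m : ℂ) ≠ 0 := by exact_mod_cast hm0.ne'
  have hR := (isResolventAt_iff_graph.1 (isResolventAt_resolvent hmem)).2 _ _ (h.sum_mem_graph hmC)
  rw [sub_add_cancel_left] at hR
  rw [← hR]
  refine ((resolvent E A m).le_of_opNorm_le hnorm _).trans_eq ?_
  rw [norm_neg, norm_smul, norm_pow, norm_inv, Complex.norm_real, Real.norm_eq_abs,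
    abs_of_pos hm0, zpow_sub_one₀ hm0.ne', zpow_natCast, inv_pow]
  field_simp

/-- With `B = (lam E - A)⁻¹ E` the chain relations give `B (c (i + 1)) = lam B (c i) - c i`, so
that `B ^ i` maps `c i` to `± c 0`, whatever `lam` is. -/
theorem pow_apply (h : IsExtendedChain E A q c w) {lam : ℂ} {R : Z →L[ℂ] X}
    (hR : IsResolventAt E A lam R) {i : ℕ} (hi : i ≤ q) :
    ((R.comp E) ^ i) (c i) = (-1 : ℂ) ^ i • c 0 ∧ ((R.comp E) ^ (i + 1)) (c i) = 0 := by
  induction i with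
  | zero => simp [h.ker]
  | succ i ih =>
    obtain ⟨ih1, ih2⟩ := ih (by omega)
    have hstep : (R.comp E) (c (i + 1)) = lam • (R.comp E) (c i) - c i := by
      have := (isResolventAt_iff_graph.1 hR).2 _ _ (h.step i (by omega))
      rw [map_sub, map_smul, sub_eq_iff_eq_add'] at this
      rw [ContinuousLinearMap.comp_apply, ContinuousLinearMap.comp_apply, this, add_sub_cancel_right]
    have hpow : ∀ j (y : X), ((R.comp E) ^ (j + 1)) y = ((R.comp E) ^ j) ((R.comp E) y) :=
      fun j y => by rw [pow_succ]; rfl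
    have h3 : ((R.comp E) ^ (i + 2)) (c i) = 0 := by
      rw [pow_succ', mul_apply_eq_comp, ih2, map_zero]
    constructor
    · rw [hpow, hstep, map_sub, map_smul, ← hpow, ih2, ih1, pow_succ]
      simp
    · rw [hpow, hstep, map_sub, map_smul, ← hpow, ih2, h3]
      simp

/-- A chain of length `q + 2` excludes radiality of order `q`. -/
theorem not_hasRadialityBound (h : IsExtendedChain E A (q + 1) c w) :
    ¬ HasRadialityBound E A q := by
  rintro ⟨ω, C, hω, hC, hmem, hb⟩
  have hlim : Tendsto (fun m : ℝ => C / (m - ω) ^ (q + 1) * ‖c (q + 1)‖) atTop (𝓝 0) := by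
    have h1 : Tendsto (fun m : ℝ => (m - ω) ^ (q + 1)) atTop atTop :=
      (tendsto_pow_atTop (Nat.succ_ne_zero q)).comp (tendsto_atTop_add_const_right _ (-ω) tendsto_id)
    simpa using (h1.const_div_atTop C).mul_const ‖c (q + 1)‖
  refine h.ne_zero (norm_le_zero_iff.1 (le_of_tendsto_of_tendsto tendsto_const_nhds hlim ?_))
  filter_upwards [eventually_gt_atTop ω] with m hm
  have hnorm := (hb (fun _ => m) fun _ => hm).1
  rw [List.ofFn_const, List.prod_replicate, Finset.prod_const, Finset.card_univ, Fintype.card_fin,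
    abs_of_pos (sub_pos.2 hm)] at hnorm
  have := ContinuousLinearMap.le_of_opNorm_le _ hnorm (c (q + 1))
  rwa [(h.pow_apply (isResolventAt_resolvent (hmem m hm)) le_rfl).1, norm_smul, norm_pow, norm_neg,
    norm_one, one_pow, one_mul] at this

end IsExtendedChain

theorem iteratedDerivWithin_exp_smul {T m : ℝ} (hT : 0 < T) (z : Z) (i : ℕ) :
    ∀ t ∈ Icc 0 T, iteratedDerivWithin i (fun t : ℝ => Real.exp (m * (t - T)) • z) (Icc 0 T) t
      = (m ^ i * Real.exp (m * (t - T))) • z := by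
  induction i with
  | zero => simp
  | succ i ih =>
    intro t ht
    rw [iteratedDerivWithin_succ, derivWithin_congr ih (ih t ht)]
    have h1 : HasDerivAt (fun s : ℝ => Real.exp (m * (s - T)))
        (Real.exp (m * (t - T)) * (m * 1)) t :=
      (((hasDerivAt_id t).sub_const T).const_mul m).exp
    have h2 := ((h1.const_mul (m ^ i)).smul_const z).hasDerivWithinAt (s := Icc 0 T)
    rw [h2.derivWithin (uniqueDiffOn_Icc hT t ht)]
    congr 1
    ring

theorem perturbationSize_exp_smul_le {T m : ℝ} (hT : 0 < T) (hm : 1 ≤ m) (q : ℕ) (z : Z) :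
    perturbationSize T q (fun t : ℝ => Real.exp (m * (t - T)) • z)
      ≤ (q + 1) * m ^ q * m⁻¹ * ‖z‖ := by
  have hm0 : 0 < m := by linarith
  rw [perturbationSize]
  split_ifs with hq
  · subst hq
    have hint : ∫ t in (0 : ℝ)..T, ‖Real.exp (m * (t - T)) • z‖
        = (1 - Real.exp (-(m * T))) * m⁻¹ * ‖z‖ := by
      have : ∀ t : ℝ, ‖Real.exp (m * (t - T)) • z‖ = Real.exp (m * t - m * T) * ‖z‖ := fun t => by
        rw [norm_smul, Real.norm_of_nonneg (Real.exp_pos _).le, mul_sub]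
      simp_rw [this]
      rw [intervalIntegral.integral_mul_const, intervalIntegral.integral_comp_mul_sub _ hm0.ne',
        integral_exp]
      simp only [smul_eq_mul, sub_self, Real.exp_zero, mul_zero, zero_sub]
      ring
    rw [hint]
    have := Real.exp_pos (-(m * T))
    simp only [Nat.cast_zero, zero_add, pow_zero, one_mul]
    refine mul_le_mul_of_nonneg_right ?_ (norm_nonneg _)
    exact mul_le_of_le_one_left (by positivity) (by linarith)
  · have hterm : ∀ i ∈ Finset.range q,
        ⨆ t : Icc (0 : ℝ) T, ‖iteratedDerivWithin i (fun t : ℝ => Real.exp (m * (t - T)) • z)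
          (Icc 0 T) t‖ ≤ m ^ q * m⁻¹ * ‖z‖ := by
      intro i hi
      refine Real.iSup_le (fun t => ?_) (by positivity)
      rw [iteratedDerivWithin_exp_smul hT z i t t.2, norm_smul, Real.norm_of_nonneg (by positivity)]
      refine mul_le_mul_of_nonneg_right ?_ (norm_nonneg _)
      obtain ⟨k, rfl⟩ : ∃ k, q = i + 1 + k := ⟨q - (i + 1), by
        have := Finset.mem_range.1 hi
        omega⟩
      have h1 : Real.exp (m * (t - T)) ≤ 1 :=
        Real.exp_le_one_iff.2 (mul_nonpos_of_nonneg_of_nonpos hm0.le (sub_nonpos.2 t.2.2))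
      have h2 : m ^ (i + 1 + k) * m⁻¹ = m ^ i * m ^ k := by
        field_simp
        ring
      rw [h2]
      exact mul_le_mul_of_nonneg_left (h1.trans (one_le_pow₀ hm)) (by positivity)
    refine (Finset.sum_le_sum hterm).trans ?_
    rw [Finset.sum_const, Finset.card_range, nsmul_eq_mul]
    have : (0 : ℝ) ≤ m ^ q * m⁻¹ * ‖z‖ := by positivity
    nlinarith

/-- A chain of length `q + 1` excludes the perturbation estimate of order `q`: the solutions
`e ^ (m (t - T)) ∑ m ^ (-i) c i` belong to the perturbations `- e ^ (m (t - T)) m ^ (-q) A (c q)`.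
As `m → ∞`, the former tend to `c 0` at `t = T`, whereas their initial values and the derivatives
of order less than `q` of the latter tend to zero. -/
theorem IsExtendedChain.not_hasPerturbationEstimate {q : ℕ} {c : ℕ → X} {w : Z}
    (h : IsExtendedChain E A q c w) {T : ℝ} (hT : 0 < T) : ¬ HasPerturbationEstimate E A T q := by
  rintro ⟨C, hC, hest⟩
  set U : ℝ → X := fun m => ∑ i ∈ Finset.range (q + 1), (m : ℂ)⁻¹ ^ i • c i with hU
  have hUlim : Tendsto U atTop (𝓝 (c 0)) := tendsto_sum c q
  have hlim : Tendsto (fun m : ℝ => C * (Real.exp (-(m * T)) * ‖U m‖ + (q + 1) * m⁻¹ * ‖w‖)) atTop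
      (𝓝 0) := by
    have h1 : Tendsto (fun m : ℝ => Real.exp (-(m * T))) atTop (𝓝 0) :=
      Real.tendsto_exp_neg_atTop_nhds_zero.comp (tendsto_id.atTop_mul_const hT)
    have h2 : Tendsto (fun m : ℝ => ((q : ℝ) + 1) * m⁻¹ * ‖w‖) atTop (𝓝 0) := by
      simpa using (tendsto_inv_atTop_zero.const_mul ((q : ℝ) + 1)).mul_const ‖w‖
    simpa using ((h1.mul hUlim.norm).add h2).const_mul C
  refine h.ne_zero (norm_le_zero_iff.1 (le_of_tendsto_of_tendsto hUlim.norm hlim ?_))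
  filter_upwards [eventually_ge_atTop 1] with m hm
  have hm0 : 0 < m := by linarith
  have hmC : (m : ℂ) ≠ 0 := by exact_mod_cast hm0.ne'
  set z : Z := -((m : ℂ)⁻¹ ^ q • w) with hz
  have hznorm : ‖z‖ = (m ^ q)⁻¹ * ‖w‖ := by
    rw [hz, norm_neg, norm_smul, norm_pow, norm_inv, Complex.norm_real, Real.norm_eq_abs,
      abs_of_pos hm0, inv_pow]
  have hgraph : ∀ a : ℝ, (a • U m, a • (m • E (U m) - z)) ∈ A.graph := fun a => by
    have := A.graph.smul_of_tower_mem a (h.sum_mem_graph hmC)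
    simpa [hz, hU] using this
  have hexp : ContDiff ℝ ⊤ fun t : ℝ => Real.exp (m * (t - T)) := by fun_prop
  have hsol : IsClassicalSolution E A T (fun t => Real.exp (m * (t - T)) • z)
      (fun t => Real.exp (m * (t - T)) • U m) := by
    have hE : (fun t => E (Real.exp (m * (t - T)) • U m))
        = fun t => Real.exp (m * (t - T)) • E (U m) := by
      funext t
      rw [ContinuousLinearMap.map_smul_of_tower]
    refine ⟨(hexp.continuous.smul continuous_const).continuousOn, ?_, fun t _ => ?_, fun t _ => ?_⟩
    · rw [hE]
      exact ((hexp.of_le le_top).smul contDiff_const).contDiffOn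
    · exact (mem_graph_iff_exists.1 (hgraph _)).1
    · obtain ⟨hd, he⟩ := mem_graph_iff_exists.1 (hgraph (Real.exp (m * (t - T))))
      refine ⟨hd, ?_⟩
      rw [he, hE]
      have h1 : HasDerivAt (fun s : ℝ => Real.exp (m * (s - T)))
          (Real.exp (m * (t - T)) * (m * 1)) t :=
        (((hasDerivAt_id t).sub_const T).const_mul m).exp
      convert (h1.smul_const (E (U m))).hasDerivWithinAt using 1
      rw [smul_sub, sub_add_cancel, smul_smul, mul_one]
  have hfin := hest _ _ ((hexp.of_le le_top).smul contDiff_const).contDiffOn hsol T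
    (right_mem_Icc.2 hT.le)
  have hsize := perturbationSize_exp_smul_le hT hm q z
  rw [hznorm] at hsize
  simp only [sub_self, mul_zero, Real.exp_zero, one_smul, zero_sub, norm_smul,
    Real.norm_of_nonneg (Real.exp_pos _).le, mul_neg] at hfin
  refine hfin.trans (mul_le_mul_of_nonneg_left (add_le_add_right (hsize.trans_eq ?_) _) hC.le)
  field_simp

end Chain

/-! ### Weierstraß forms in coordinates -/

section Split

variable {X : Type u} [NormedAddCommGroup X] [InnerProductSpace ℂ X]
  {Z : Type v} [NormedAddCommGroup Z] [InnerProductSpace ℂ Z]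
  {Y₁ : Type w} [NormedAddCommGroup Y₁] [InnerProductSpace ℂ Y₁]
  {Y₂ : Type w} [NormedAddCommGroup Y₂] [InnerProductSpace ℂ Y₂]
  {E : X →L[ℂ] Z} {A : X →ₗ.[ℂ] Z} {N : Y₂ →L[ℂ] Y₂} {A₁ : Y₁ →ₗ.[ℂ] Y₁}
  {P : X ≃L[ℂ] Y₁ × Y₂} {Q : Z ≃L[ℂ] Y₁ × Y₂}

/-- In the coordinates `P` on `X` and `Q` on `Z` the pair `(E, A)` is `(diag(I, N), diag(A₁, I))`.
Since only the topology of `Y₁ ⊕ Y₂` matters, the plain product carries the coordinates. -/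
structure IsSplit (P : X ≃L[ℂ] Y₁ × Y₂) (Q : Z ≃L[ℂ] Y₁ × Y₂) (E : X →L[ℂ] Z) (A : X →ₗ.[ℂ] Z)
    (N : Y₂ →L[ℂ] Y₂) (A₁ : Y₁ →ₗ.[ℂ] Y₁) : Prop where
  map_E : ∀ x, Q (E x) = ((P x).1, N (P x).2)
  mem_graph : ∀ x z, (x, z) ∈ A.graph ↔ ((P x).1, (Q z).1) ∈ A₁.graph ∧ (P x).2 = (Q z).2

theorem IsWeierstrassForm.exists_isSplit (h : IsWeierstrassForm E A N A₁) :
    ∃ (P : X ≃L[ℂ] Y₁ × Y₂) (Q : Z ≃L[ℂ] Y₁ × Y₂), IsSplit P Q E A N A₁ := by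
  obtain ⟨-, P, Q, hE, hA⟩ := h
  refine ⟨P.trans (WithLp.prodContinuousLinearEquiv 2 ℂ Y₁ Y₂),
    Q.trans (WithLp.prodContinuousLinearEquiv 2 ℂ Y₁ Y₂), fun x => ?_, fun x z => ?_⟩
  · rw [ContinuousLinearEquiv.trans_apply, hE, ContinuousLinearEquiv.apply_symm_apply]
    rfl
  · rw [hA, mem_graph_iff_exists, mem_graph_iff_exists]
    constructor
    · rintro ⟨hd, he⟩
      have he' := congrArg (WithLp.prodContinuousLinearEquiv 2 ℂ Y₁ Y₂) he
      exact ⟨⟨hd, congrArg Prod.fst he'⟩, (congrArg Prod.snd he' :)⟩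
    · rintro ⟨⟨hd, he⟩, he2⟩
      exact ⟨hd, (WithLp.prodContinuousLinearEquiv 2 ℂ Y₁ Y₂).injective (Prod.ext he he2)⟩

theorem exists_pow_apply_ne_zero {q : ℕ} (hq : q < nilpotencyClass N) :
    ∃ v, (N ^ q) v ≠ 0 ∧ (N ^ (q + 1)) v = 0 := by
  obtain ⟨k, hk⟩ : ∃ k, nilpotencyClass N = k + 1 + q :=
    ⟨nilpotencyClass N - (q + 1), by omega⟩
  have h0 := (nilpotencyClass_eq_succ_iff (x := N) (k := q + k)).1 (by omega)
  obtain ⟨z, hz⟩ : ∃ z, (N ^ (q + k)) z ≠ 0 := by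
    by_contra! hc
    exact h0.2 (ContinuousLinearMap.ext hc)
  refine ⟨(N ^ k) z, ?_, ?_⟩
  · rwa [← mul_apply_eq_comp, ← pow_add]
  · rw [← mul_apply_eq_comp, ← pow_add, add_right_comm, h0.1]
    rfl

namespace IsSplit

/-- Every `q` below the nilpotency class gives a chain of length `q + 1`, coming from a Jordan chain
of `N`. -/
theorem exists_isExtendedChain (h : IsSplit P Q E A N A₁) {q : ℕ}
    (hq : q < nilpotencyClass N) : ∃ c w, IsExtendedChain E A q c w := by
  obtain ⟨v, hv, hv0⟩ := exists_pow_apply_ne_zero hq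
  have hE : ∀ y, E (P.symm (0, y)) = Q.symm (0, N y) := fun y => Q.injective (by
    rw [h.map_E]
    simp)
  have hA : ∀ y, (P.symm (0, y), Q.symm (0, y)) ∈ A.graph := fun y => by
    rw [h.mem_graph]
    simp
  refine ⟨fun i => P.symm (0, (N ^ (q - i)) v), Q.symm (0, v), ?_, ?_, fun i hi => ?_, ?_⟩
  · simpa using hv
  · rw [hE, ← mul_apply_eq_comp, ← pow_succ', Nat.sub_zero, hv0]
    simp
  · rw [hE, ← mul_apply_eq_comp, ← pow_succ', show q - (i + 1) + 1 = q - i by omega]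
    exact hA _
  · simpa using hA v

theorem le_of_hasChainOfLength (h : IsSplit P Q E A N A₁) {p l : ℕ} (hN : N ^ p = 0)
    (hl : HasChainOfLength E A l) : l ≤ p := by
  obtain ⟨-, c, hc0, hker, hstep⟩ := hl
  by_contra! hlt
  have hs : ∀ i, i + 1 < l → (P (c i)).2 = N (P (c (i + 1))).2 := by
    intro i hi
    have := ((h.mem_graph _ _).1 (mem_graph_iff_exists.2
      ((hstep i hi).imp fun _ e => e.symm))).2
    rwa [h.map_E] at this
  have hpow : ∀ i, i < l → (P (c 0)).2 = (N ^ i) (P (c i)).2 := by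
    intro i
    induction i with
    | zero => simp
    | succ i ih =>
      intro hi
      rw [ih (by omega), hs i hi, pow_succ]
      rfl
  have hk := h.map_E (c 0)
  rw [hker, map_zero, eq_comm, Prod.mk_eq_zero] at hk
  have h2 : (P (c 0)).2 = 0 := by
    rw [hpow p hlt, hN]
    rfl
  exact hc0 (P.map_eq_zero_iff.1 (Prod.ext hk.1 h2))

/-- The chain index of a pair is the nilpotency class in each of its Weierstraß forms, which is
therefore the same for all of them. -/
theorem isChainIndex (h : IsSplit P Q E A N A₁) (hN : IsNilpotent N) :
    IsChainIndex E A (nilpotencyClass N) := by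
  refine ⟨fun l hl => h.le_of_hasChainOfLength (pow_nilpotencyClass hN) hl, fun b hb => ?_⟩
  rcases Nat.eq_zero_or_pos (nilpotencyClass N) with h0 | h0
  · omega
  · obtain ⟨c, w, hc⟩ := h.exists_isExtendedChain (Nat.pred_lt h0.ne')
    refine hb ⟨h0, c, hc.ne_zero, hc.ker, fun i hi => ?_⟩
    obtain ⟨hd, he⟩ := mem_graph_iff_exists.1 (hc.step i (Nat.lt_pred_of_succ_lt hi))
    exact ⟨hd, he.symm⟩

end IsSplit

/-! ### The resolvent in a Weierstraß form -/

/-- The inverse of `lam N - I` if `N ^ p = 0`, a finite Neumann series. -/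
noncomputable def nilpotentResolvent (N : Y₂ →L[ℂ] Y₂) (p : ℕ) (lam : ℂ) : Y₂ →L[ℂ] Y₂ :=
  -∑ k ∈ Finset.range p, (lam • N) ^ k

theorem nilpotentResolvent_mul {p : ℕ} (hN : N ^ p = 0) (lam : ℂ) :
    nilpotentResolvent N p lam * (lam • N - 1) = 1 := by
  rw [nilpotentResolvent, neg_mul, geom_sum_mul, smul_pow, hN, smul_zero, zero_sub, neg_neg]

theorem mul_nilpotentResolvent {p : ℕ} (hN : N ^ p = 0) (lam : ℂ) :
    (lam • N - 1) * nilpotentResolvent N p lam = 1 := by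
  rw [nilpotentResolvent, mul_neg, mul_geom_sum, smul_pow, hN, smul_zero, zero_sub, neg_neg]

theorem commute_nilpotentResolvent (N : Y₂ →L[ℂ] Y₂) (p : ℕ) (lam : ℂ) :
    Commute (nilpotentResolvent N p lam) N := by
  refine (Commute.sum_left _ _ _ fun k _ => ?_).neg_left
  exact ((Commute.refl N).smul_left lam).pow_left k

theorem norm_nilpotentResolvent_le (N : Y₂ →L[ℂ] Y₂) (p : ℕ) {lam : ℝ} (hlam : 1 ≤ lam) :
    ‖nilpotentResolvent N p lam‖ ≤ (∑ k ∈ Finset.range p, ‖N ^ k‖) * lam ^ ((p : ℤ) - 1) := by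
  rw [nilpotentResolvent, norm_neg, Finset.sum_mul]
  refine norm_sum_le_of_le _ fun k hk => ?_
  rw [smul_pow, norm_smul, norm_pow, Complex.norm_real, Real.norm_of_nonneg (by linarith),
    mul_comm, ← zpow_natCast lam k]
  refine mul_le_mul_of_nonneg_left (zpow_le_zpow_right₀ hlam ?_) (norm_nonneg _)
  have := Finset.mem_range.1 hk
  omega

namespace IsSplit

theorem isResolventAt (h : IsSplit P Q E A N A₁) {p : ℕ} (hN : N ^ p = 0) {lam : ℝ}
    {R : Y₁ →L[ℂ] Y₁} (hR : ∀ y, (R y, lam • R y - y) ∈ A₁.graph)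
    (hR' : ∀ x y, (x, y) ∈ A₁.graph → R (lam • x - y) = x) :
    IsResolventAt E A lam ((P.symm : Y₁ × Y₂ →L[ℂ] X).comp
      ((R.prodMap (nilpotentResolvent N p lam)).comp (Q : Z →L[ℂ] Y₁ × Y₂))) := by
  have hQ : ∀ x, Q ((lam : ℂ) • E x) = ((lam : ℂ) • (P x).1, (lam : ℂ) • N (P x).2) := fun x => by
    rw [map_smul, h.map_E, Prod.smul_mk]
  rw [isResolventAt_iff_graph]
  constructor
  · intro z
    have h2 := congrArg (fun B : Y₂ →L[ℂ] Y₂ => B (Q z).2) (mul_nilpotentResolvent hN (lam : ℂ))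
    have hP : P (P.symm ((R.prodMap (nilpotentResolvent N p lam)) (Q z)))
        = (R (Q z).1, nilpotentResolvent N p lam (Q z).2) := P.apply_symm_apply _
    refine (h.mem_graph _ _).2 ?_
    simp only [ContinuousLinearMap.comp_apply, ContinuousLinearEquiv.coe_coe]
    rw [map_sub, hQ, hP]
    have h2' : (lam : ℂ) • N (nilpotentResolvent N p lam (Q z).2) - nilpotentResolvent N p lam (Q z).2
        = (Q z).2 := h2
    exact ⟨hR _, eq_sub_of_add_eq (sub_eq_iff_eq_add'.1 h2').symm⟩
  · intro x z hxz
    obtain ⟨h1, h2⟩ := (h.mem_graph x z).1 hxz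
    have h3 := congrArg (fun B : Y₂ →L[ℂ] Y₂ => B (P x).2) (nilpotentResolvent_mul hN (lam : ℂ))
    refine P.injective ?_
    simp only [ContinuousLinearMap.comp_apply, ContinuousLinearEquiv.coe_coe]
    rw [P.apply_symm_apply, map_sub, hQ]
    refine Prod.ext (hR' _ _ h1) ?_
    change nilpotentResolvent N p lam ((lam : ℂ) • N (P x).2 - (Q z).2) = (P x).2
    rw [← h2]
    exact h3

end IsSplit

/-- In the coordinates of a split form, a product of block diagonal operators is block diagonal. -/
theorem apply_prod_ofFn {V : Type*} [NormedAddCommGroup V] [NormedSpace ℂ V] (P : V ≃L[ℂ] Y₁ × Y₂)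
    {n : ℕ} {B : Fin n → V →L[ℂ] V} {F : Fin n → Y₁ →L[ℂ] Y₁} {G : Fin n → Y₂ →L[ℂ] Y₂}
    (hB : ∀ k x, P (B k x) = (F k (P x).1, G k (P x).2)) (x : V) :
    P ((List.ofFn B).prod x) = ((List.ofFn F).prod (P x).1, (List.ofFn G).prod (P x).2) := by
  induction n with
  | zero => simp
  | succ n ih =>
    simp only [List.ofFn_succ, List.prod_cons, mul_apply_eq_comp]
    rw [hB, ih fun k => hB k.succ]

theorem prod_ofFn_mul_eq_zero {n : ℕ} {S : Fin n → Y₂ →L[ℂ] Y₂} (hS : ∀ k, Commute (S k) N)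
    (hN : N ^ n = 0) : (List.ofFn fun k => S k * N).prod = 0 := by
  have key : ∀ (n : ℕ) (S : Fin n → Y₂ →L[ℂ] Y₂), (∀ k, Commute (S k) N) →
      (List.ofFn fun k => S k * N).prod = (List.ofFn S).prod * N ^ n := by
    intro n
    induction n with
    | zero => simp
    | succ n ih =>
      intro S hS
      have hc : Commute (List.ofFn fun k : Fin n => S k.succ).prod N :=
        Commute.list_prod_left _ _ fun B hB => by
          obtain ⟨k, rfl⟩ := List.mem_ofFn.1 hB
          exact hS _
      rw [List.ofFn_succ, List.prod_cons, ih _ fun k => hS k.succ, List.ofFn_succ, List.prod_cons,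
        mul_assoc, ← mul_assoc N, ← hc.eq, pow_succ', mul_assoc, mul_assoc]
  rw [key n S hS, hN, mul_zero]

/-- An operator that is `F ⊕ 0` in the coordinates `P` has norm at most `‖P⁻¹‖ ‖F‖ ‖P‖`. -/
theorem norm_le_of_fst {V : Type*} [NormedAddCommGroup V] [NormedSpace ℂ V] (P : V ≃L[ℂ] Y₁ × Y₂)
    {B : V →L[ℂ] V} {F : Y₁ →L[ℂ] Y₁} (hB : ∀ x, P (B x) = (F (P x).1, 0)) :
    ‖B‖ ≤ ‖(P.symm : Y₁ × Y₂ →L[ℂ] V)‖ * ‖F‖ * ‖(P : V →L[ℂ] Y₁ × Y₂)‖ := by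
  refine ContinuousLinearMap.opNorm_le_bound _ (by positivity) fun x => ?_
  have h1 : B x = (P.symm : Y₁ × Y₂ →L[ℂ] V) (F (P x).1, 0) := by
    rw [← hB]
    exact (P.symm_apply_apply _).symm
  have h2 : ‖(F (P x).1, (0 : Y₂))‖ ≤ ‖F‖ * (‖(P : V →L[ℂ] Y₁ × Y₂)‖ * ‖x‖) := by
    rw [Prod.norm_mk, norm_zero, max_eq_left (norm_nonneg _)]
    refine (F.le_opNorm _).trans (mul_le_mul_of_nonneg_left ?_ (norm_nonneg _))
    exact (norm_fst_le _).trans ((P : V →L[ℂ] Y₁ × Y₂).le_opNorm x)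
  rw [h1, mul_assoc, mul_assoc]
  exact (ContinuousLinearMap.le_opNorm _ _).trans (mul_le_mul_of_nonneg_left h2 (norm_nonneg _))

namespace IsSplit

variable [CompleteSpace Y₁] {T : ℝ → Y₁ →L[ℂ] Y₁}

theorem hasResolventBound (h : IsSplit P Q E A N A₁) {p : ℕ} (hN : N ^ p = 0)
    (hT : IsC0Semigroup T) (hA₁ : IsGenerator T A₁) : HasResolventBound E A p := by
  obtain ⟨M, ω, hM1, hω, hM⟩ := hT.exists_growthBound
  set K : ℝ := ∑ k ∈ Finset.range p, ‖N ^ k‖ with hK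
  have hK0 : 0 ≤ K := Finset.sum_nonneg fun _ _ => norm_nonneg _
  -- to the right of `2 ω + 1` the two bounds `M / (lam - ω)` and `2 M / lam` are comparable
  refine ⟨2 * ω + 1, ‖(P.symm : Y₁ × Y₂ →L[ℂ] X)‖ * ((2 * M + K) * ‖(Q : Z →L[ℂ] Y₁ × Y₂)‖) + 1,
    by positivity, fun lam hlam => ?_⟩
  have hlam1 : 1 ≤ lam := by linarith
  have hlam0 : 0 < lam := by linarith
  obtain ⟨R, hR, hR', hRb⟩ := hT.exists_resolvent hM hA₁ (lam := lam) (by linarith)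
  have hres := h.isResolventAt hN hR hR'
  refine ⟨⟨_, hres⟩, ?_⟩
  rw [← hres.eq_resolvent, abs_of_pos hlam0]
  have hpow : lam ^ (-1 : ℤ) ≤ lam ^ ((p : ℤ) - 1) := zpow_le_zpow_right₀ hlam1 (by omega)
  have hpow0 : 0 < lam ^ ((p : ℤ) - 1) := zpow_pos hlam0 _
  have hRn : ‖R‖ ≤ 2 * M * lam ^ ((p : ℤ) - 1) := by
    have h1 : ‖R‖ ≤ M / (lam - ω) := by
      refine R.opNorm_le_bound (div_nonneg (by linarith) (by linarith)) fun y => ?_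
      have := hRb y (M * ‖y‖) (fun s hs => by
        refine ((T s).le_of_opNorm_le (hM s hs) y).trans_eq ?_
        ring) 0 le_rfl
      rwa [hT.zero, mul_zero, Real.exp_zero, mul_one, mul_div_right_comm] at this
    refine h1.trans (le_trans ?_ (mul_le_mul_of_nonneg_left hpow (by linarith)))
    rw [zpow_neg_one, ← div_eq_mul_inv, div_le_div_iff₀ (by linarith) hlam0]
    nlinarith
  have hprod : ‖R.prodMap (nilpotentResolvent N p lam)‖ ≤ (2 * M + K) * lam ^ ((p : ℤ) - 1) := by
    refine ContinuousLinearMap.opNorm_le_bound _ (by positivity) fun y => ?_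
    refine max_le ?_ ?_
    · refine (R.le_of_opNorm_le hRn _).trans ?_
      gcongr
      · linarith
      · exact norm_fst_le y
    · refine (ContinuousLinearMap.le_of_opNorm_le _ (norm_nilpotentResolvent_le N p hlam1) _).trans ?_
      gcongr
      · linarith
      · exact norm_snd_le y
  calc _ ≤ ‖(P.symm : Y₁ × Y₂ →L[ℂ] X)‖
        * (((2 * M + K) * lam ^ ((p : ℤ) - 1)) * ‖(Q : Z →L[ℂ] Y₁ × Y₂)‖) := by
        refine (ContinuousLinearMap.opNorm_comp_le _ _).trans ?_
        gcongr
        refine (ContinuousLinearMap.opNorm_comp_le _ _).trans ?_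
        gcongr
    _ ≤ _ := by nlinarith

/-- `r + 1` factors suffice to annihilate the nilpotent part; the remaining part is covered by the
Hille–Yosida estimates. -/
theorem hasRadialityBound (h : IsSplit P Q E A N A₁) {r : ℕ} (hN : N ^ (r + 1) = 0)
    (hT : IsC0Semigroup T) (hA₁ : IsGenerator T A₁) : HasRadialityBound E A r := by
  obtain ⟨M, ω, hM1, hω, hM⟩ := hT.exists_growthBound
  choose! R hR hR' hRb using fun (lam : ℝ) (hlam : ω < lam) => hT.exists_resolvent hM hA₁ hlam
  set S : ℝ → Y₂ →L[ℂ] Y₂ := fun lam => nilpotentResolvent N (r + 1) lam with hS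
  have hres : ∀ lam, ω < lam → IsResolventAt E A lam _ := fun lam hlam =>
    h.isResolventAt hN (hR lam hlam) (hR' lam hlam)
  refine ⟨ω, (‖(P.symm : Y₁ × Y₂ →L[ℂ] X)‖ * ‖(P : X →L[ℂ] Y₁ × Y₂)‖
    + ‖(Q.symm : Y₁ × Y₂ →L[ℂ] Z)‖ * ‖(Q : Z →L[ℂ] Y₁ × Y₂)‖) * M + 1, hω, by positivity,
    fun lam hlam => ⟨_, hres lam hlam⟩, fun l hl => ?_⟩
  have hPres : ∀ lam, ω < lam → ∀ z,
      P (resolvent E A lam z) = (R lam (Q z).1, S lam (Q z).2) := fun lam hlam z => by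
    rw [← (hres lam hlam).eq_resolvent]
    exact P.apply_symm_apply _
  have hprod := hT.norm_prod_resolvent_le hM (by linarith) hRb l hl
  have hpos : 0 < ∏ k, (l k - ω) := Finset.prod_pos fun k _ => sub_pos.2 (hl k)
  have habs : ∏ k, |l k - ω| = ∏ k, (l k - ω) :=
    Finset.prod_congr rfl fun k _ => abs_of_pos (sub_pos.2 (hl k))
  rw [habs]
  have hzero : (List.ofFn fun k => S (l k) * N).prod = 0 :=
    prod_ofFn_mul_eq_zero (fun k => commute_nilpotentResolvent N _ _) hN
  have hfin : ∀ a b c : ℝ, 0 ≤ a → 0 ≤ b → a * b ≤ c →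
      a * ‖(List.ofFn fun k => R (l k)).prod‖ * b ≤ (c * M + 1) / ∏ k, (l k - ω) := by
    intro a b c ha hb hc
    calc _ = a * b * ‖(List.ofFn fun k => R (l k)).prod‖ := by ring
      _ ≤ a * b * (M / ∏ k, (l k - ω)) := by gcongr
      _ = a * b * M / ∏ k, (l k - ω) := by ring
      _ ≤ _ := by
        gcongr
        nlinarith
  constructor
  · refine (norm_le_of_fst P (F := (List.ofFn fun k => R (l k)).prod) fun x => ?_).trans ?_
    · rw [apply_prod_ofFn P (F := fun k => R (l k)) (G := fun k => S (l k) * N), hzero]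
      · rfl
      · intro k x
        rw [ContinuousLinearMap.comp_apply, hPres _ (hl k), h.map_E]
        rfl
    · exact hfin _ _ _ (by positivity) (by positivity) (le_add_of_nonneg_right (by positivity))
  · refine (norm_le_of_fst Q (F := (List.ofFn fun k => R (l k)).prod) fun x => ?_).trans ?_
    · rw [apply_prod_ofFn Q (F := fun k => R (l k)) (G := fun k => S (l k) * N), hzero]
      · rfl
      · intro k x
        rw [ContinuousLinearMap.comp_apply, h.map_E, hPres _ (hl k),
          (commute_nilpotentResolvent N (r + 1) (l k)).eq]
        rfl
    · exact hfin _ _ _ (by positivity) (by positivity) (le_add_of_nonneg_left (by positivity))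

end IsSplit
end Split
/-! ### The underlying ordinary differential equation -/

section UnderlyingODE

variable {X : Type u} [NormedAddCommGroup X] [InnerProductSpace ℂ X]
  {Z : Type v} [NormedAddCommGroup Z] [InnerProductSpace ℂ Z]
  {Y₁ : Type w} [NormedAddCommGroup Y₁] [InnerProductSpace ℂ Y₁]
  {Y₂ : Type w} [NormedAddCommGroup Y₂] [InnerProductSpace ℂ Y₂]
  {E : X →L[ℂ] Z} {A : X →ₗ.[ℂ] Z} {N : Y₂ →L[ℂ] Y₂} {A₁ : Y₁ →ₗ.[ℂ] Y₁}
  {P : X ≃L[ℂ] Y₁ × Y₂} {Q : Z ≃L[ℂ] Y₁ × Y₂}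

/-- The operator `diag(A₁, 0)` in the coordinates `P`. -/
noncomputable def extendByZero (P : X ≃L[ℂ] Y₁ × Y₂) (A₁ : Y₁ →ₗ.[ℂ] Y₁) : X →ₗ.[ℂ] X where
  domain := A₁.domain.comap (LinearMap.fst ℂ Y₁ Y₂ ∘ₗ (P : X →ₗ[ℂ] Y₁ × Y₂))
  toFun := (P.symm : Y₁ × Y₂ →ₗ[ℂ] X) ∘ₗ LinearMap.inl ℂ Y₁ Y₂ ∘ₗ A₁.toFun ∘ₗ
    ((LinearMap.fst ℂ Y₁ Y₂ ∘ₗ (P : X →ₗ[ℂ] Y₁ × Y₂)).restrict fun _ hx => hx)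

theorem mem_graph_extendByZero {x y : X} :
    (x, y) ∈ (extendByZero P A₁).graph ↔ ((P x).1, (P y).1) ∈ A₁.graph ∧ (P y).2 = 0 := by
  rw [mem_graph_iff_exists, mem_graph_iff_exists]
  constructor
  · rintro ⟨h, e⟩
    have e' : P.symm (A₁ ⟨(P x).1, h⟩, 0) = y := e
    rw [← e', P.apply_symm_apply]
    exact ⟨⟨h, rfl⟩, rfl⟩
  · rintro ⟨⟨h, e⟩, e2⟩
    refine ⟨h, ?_⟩
    change P.symm (A₁ ⟨(P x).1, h⟩, 0) = y
    rw [P.symm_apply_eq]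
    exact Prod.ext e e2.symm

/-- `diag(A₁, 0)` generates the semigroup `diag(T, I)`. -/
theorem generatesC0Semigroup_extendByZero (P : X ≃L[ℂ] Y₁ × Y₂) {T : ℝ → Y₁ →L[ℂ] Y₁}
    (hT : IsC0Semigroup T) (hA₁ : IsGenerator T A₁) :
    GeneratesC0Semigroup (extendByZero P A₁) := by
  refine ⟨fun t => (P.symm : Y₁ × Y₂ →L[ℂ] X).comp
    (((T t).prodMap (ContinuousLinearMap.id ℂ Y₂)).comp (P : X →L[ℂ] Y₁ × Y₂)), ?_, ?_, ?_, ?_⟩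
  · ext x
    simp [hT.zero]
  · intro s t hs ht
    refine ContinuousLinearMap.ext fun x => P.injective ?_
    simp [hT.add s t hs ht, Prod.map]
  · intro x
    exact P.symm.continuous.comp_continuousOn
      ((hT.continuousOn (P x).1).prodMk continuousOn_const)
  · intro x y
    rw [mem_graph_extendByZero, hA₁]
    have hP : ∀ t : ℝ, P (t⁻¹ • (P.symm (T t (P x).1, (P x).2) - x))
        = (t⁻¹ • (T t (P x).1 - (P x).1), 0) := fun t => by
      have h1 : P (t⁻¹ • (P.symm (T t (P x).1, (P x).2) - x))
          = t⁻¹ • P (P.symm (T t (P x).1, (P x).2) - x) :=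
        (P : X →L[ℂ] Y₁ × Y₂).map_smul_of_tower _ _
      rw [h1, map_sub, P.apply_symm_apply]
      exact Prod.ext rfl (by simp)
    rw [P.toHomeomorph.isInducing.tendsto_nhds_iff, Prod.tendsto_iff]
    refine and_congr ?_ ?_
    · exact tendsto_congr fun t => (congrArg Prod.fst (hP t)).symm
    · refine Iff.trans ?_ (tendsto_congr fun t => (congrArg Prod.snd (hP t)).symm)
      exact eq_comm.trans tendsto_const_nhds_iff.symm

variable {T : ℝ → Y₁ →L[ℂ] Y₁}

namespace IsSplit

/-- Eliminating `x 2, …, x (p + 1)` from the derivative array by means of `N ^ p = 0` leaves the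
differential equation of the semigroup part and an algebraic equation for the nilpotent part. -/
theorem hasUnderlyingODE (h : IsSplit P Q E A N A₁) {p : ℕ} (hN : N ^ p = 0)
    (hT : IsC0Semigroup T) (hA₁ : IsGenerator T A₁) : HasUnderlyingODE E A p := by
  refine ⟨extendByZero P A₁, fun i => Nat.casesOn i
    ((P.symm : Y₁ × Y₂ →L[ℂ] X).comp ((ContinuousLinearMap.inl ℂ Y₁ Y₂).comp
      ((ContinuousLinearMap.fst ℂ Y₁ Y₂).comp (Q : Z →L[ℂ] Y₁ × Y₂))))
    (fun i => -(P.symm : Y₁ × Y₂ →L[ℂ] X).comp ((ContinuousLinearMap.inr ℂ Y₁ Y₂).comp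
      ((N ^ i).comp ((ContinuousLinearMap.snd ℂ Y₁ Y₂).comp (Q : Z →L[ℂ] Y₁ × Y₂))))),
    generatesC0Semigroup_extendByZero P hT hA₁, fun x f hx => ?_⟩
  have hg : ∀ i ≤ p, ((P (x i)).1, (P (x (i + 1))).1 - (Q (f i)).1) ∈ A₁.graph ∧
      (P (x i)).2 = N (P (x (i + 1))).2 - (Q (f i)).2 := by
    intro i hi
    obtain ⟨hd, he⟩ := hx i hi
    have := (h.mem_graph _ _).1 (A.mem_graph ⟨_, hd⟩)
    rwa [← add_sub_cancel_right (A ⟨x i, hd⟩) (f i), ← he, map_sub, h.map_E] at this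
  have hsum : ∀ j ≤ p, (P (x 1)).2
      = (N ^ j) (P (x (j + 1))).2 - ∑ i ∈ Finset.range j, (N ^ i) (Q (f (i + 1))).2 := by
    intro j
    induction j with
    | zero => simp
    | succ j ih =>
      intro hj
      rw [ih (by omega), (hg (j + 1) hj).2, Finset.sum_range_succ, map_sub, pow_succ,
        mul_apply_eq_comp]
      abel
  have hmem : (x 0, P.symm ((P (x 1)).1 - (Q (f 0)).1, 0)) ∈ (extendByZero P A₁).graph := by
    rw [mem_graph_extendByZero, P.apply_symm_apply]
    exact ⟨(hg 0 p.zero_le).1, rfl⟩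
  obtain ⟨hd, he⟩ := mem_graph_iff_exists.1 hmem
  refine ⟨hd, P.injective ?_⟩
  have h1 := hsum p le_rfl
  rw [hN, zero_apply, zero_sub] at h1
  rw [he, Finset.sum_range_succ', map_add, map_add, map_sum, P.apply_symm_apply]
  refine Prod.ext ?_ ?_
  · simp [Prod.fst_sum]
  · simp [Prod.snd_sum, h1]

end IsSplit

end UnderlyingODE

/-! ### The perturbation estimate -/

section Perturbation

variable {X : Type u} [NormedAddCommGroup X] [InnerProductSpace ℂ X]
  {Z : Type v} [NormedAddCommGroup Z] [InnerProductSpace ℂ Z]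
  {Y₁ : Type w} [NormedAddCommGroup Y₁] [InnerProductSpace ℂ Y₁]
  {Y₂ : Type w} [NormedAddCommGroup Y₂] [InnerProductSpace ℂ Y₂]
  {E : X →L[ℂ] Z} {A : X →ₗ.[ℂ] Z} {N : Y₂ →L[ℂ] Y₂} {A₁ : Y₁ →ₗ.[ℂ] Y₁}
  {P : X ≃L[ℂ] Y₁ × Y₂} {Q : Z ≃L[ℂ] Y₁ × Y₂}

theorem perturbationSize_nonneg {T : ℝ} (hT : 0 ≤ T) (p : ℕ) (δ : ℝ → Z) :
    0 ≤ perturbationSize T p δ := by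
  rw [perturbationSize]
  split_ifs
  · exact intervalIntegral.integral_nonneg hT fun _ _ => norm_nonneg _
  · exact Finset.sum_nonneg fun _ _ => Real.iSup_nonneg fun _ => norm_nonneg _

theorem norm_iteratedDerivWithin_le_perturbationSize {T : ℝ} (hT : 0 < T) {p k : ℕ} (hk : k < p)
    {δ : ℝ → Z} (hδ : ContDiffOn ℝ ((p - 1 : ℕ) : WithTop ℕ∞) δ (Icc 0 T)) {t : ℝ}
    (ht : t ∈ Icc 0 T) : ‖iteratedDerivWithin k δ (Icc 0 T) t‖ ≤ perturbationSize T p δ := by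
  rw [perturbationSize, if_neg (by omega)]
  have hc : ContinuousOn (iteratedDerivWithin k δ (Icc 0 T)) (Icc 0 T) :=
    hδ.continuousOn_iteratedDerivWithin (by exact_mod_cast Nat.le_pred_of_lt hk)
      (uniqueDiffOn_Icc hT)
  obtain ⟨C, hC⟩ := isCompact_Icc.exists_bound_of_continuousOn hc
  have h1 : ‖iteratedDerivWithin k δ (Icc 0 T) t‖
      ≤ ⨆ t : Icc (0 : ℝ) T, ‖iteratedDerivWithin k δ (Icc 0 T) t‖ :=
    le_ciSup (f := fun t : Icc (0 : ℝ) T => ‖iteratedDerivWithin k δ (Icc 0 T) t‖)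
      ⟨C, by
        rintro _ ⟨s, rfl⟩
        exact hC s s.2⟩ ⟨t, ht⟩
  exact h1.trans (Finset.single_le_sum
    (f := fun i => ⨆ t : Icc (0 : ℝ) T, ‖iteratedDerivWithin i δ (Icc 0 T) t‖)
    (fun _ _ => Real.iSup_nonneg fun _ => norm_nonneg _) (Finset.mem_range.2 hk))

theorem integral_norm_le_perturbationSize {T : ℝ} (hT : 0 < T) {p : ℕ}
    {δ : ℝ → Z} (hδ : ContDiffOn ℝ ((p - 1 : ℕ) : WithTop ℕ∞) δ (Icc 0 T)) :
    ∫ t in (0 : ℝ)..T, ‖δ t‖ ≤ (T + 1) * perturbationSize T p δ := by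
  have h0 := perturbationSize_nonneg hT.le p δ
  rcases Nat.eq_zero_or_pos p with rfl | hp
  · have : perturbationSize T 0 δ = ∫ t in (0 : ℝ)..T, ‖δ t‖ := if_pos rfl
    rw [← this]
    nlinarith
  · have h1 : ∫ t in (0 : ℝ)..T, ‖δ t‖ ≤ ∫ _ in (0 : ℝ)..T, perturbationSize T p δ := by
      refine intervalIntegral.integral_mono_on hT.le
        (hδ.continuousOn.norm.intervalIntegrable_of_Icc hT.le) intervalIntegrable_const
        fun t ht => ?_
      simpa using norm_iteratedDerivWithin_le_perturbationSize hT hp hδ ht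
    rw [intervalIntegral.integral_const, smul_eq_mul] at h1
    linarith

theorem hasDerivWithinAt_clm_comp {V W : Type*} [NormedAddCommGroup V] [NormedSpace ℂ V]
    [NormedAddCommGroup W] [NormedSpace ℂ W] (L : V →L[ℂ] W) {f : ℝ → V} {f' : V} {s : Set ℝ}
    {t : ℝ} (hf : HasDerivWithinAt f f' s t) :
    HasDerivWithinAt (fun r => L (f r)) (L f') s t :=
  (L.restrictScalars ℝ).hasFDerivAt.comp_hasDerivWithinAt t hf

/-- The nilpotent part: differentiating `(N b)' = b + h` repeatedly and using `N ^ p = 0` gives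
`b = - ∑ N ^ k h⁽ᵏ⁾`. Here `h = L δ`, and the induction runs downwards over the powers of `N`. -/
theorem pow_apply_eq_neg_sum {T : ℝ} (hT : 0 < T) {p : ℕ} (hN : N ^ p = 0) {δ : ℝ → Z}
    (hδ : ContDiffOn ℝ ((p - 1 : ℕ) : WithTop ℕ∞) δ (Icc 0 T)) (L : Z →L[ℂ] Y₂) {b : ℝ → Y₂}
    (hb : ∀ t ∈ Ioc 0 T, HasDerivWithinAt (fun s => N (b s)) (b t + L (δ t)) (Ioc 0 T) t)
    {j m : ℕ} (hjm : j + m = p) : ∀ t ∈ Ioc 0 T, (N ^ m) (b t)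
      = -∑ k ∈ Finset.range j, (N ^ (m + k)) (L (iteratedDerivWithin k δ (Icc 0 T) t)) := by
  induction j generalizing m with
  | zero =>
    intro t _
    rw [← hjm, zero_add] at hN
    simp [hN]
  | succ j ih =>
    intro t ht
    have hder1 := hasDerivWithinAt_clm_comp (N ^ m) (hb t ht)
    have hder2 : HasDerivWithinAt (fun s => -∑ k ∈ Finset.range j,
        (N ^ (m + 1 + k)) (L (iteratedDerivWithin k δ (Icc 0 T) s)))
        (-∑ k ∈ Finset.range j,
          (N ^ (m + 1 + k)) (L (iteratedDerivWithin (k + 1) δ (Icc 0 T) t))) (Ioc 0 T) t := by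
      refine (HasDerivWithinAt.fun_sum fun k hk => ?_).neg
      have hkj := Finset.mem_range.1 hk
      have hd := (hδ.differentiableOn_iteratedDerivWithin (m := k)
        (by exact_mod_cast (show k < p - 1 by omega)) (uniqueDiffOn_Icc hT) t
        (Ioc_subset_Icc_self ht)).hasDerivWithinAt
      rw [← iteratedDerivWithin_succ] at hd
      exact hasDerivWithinAt_clm_comp (N ^ (m + 1 + k))
        (hasDerivWithinAt_clm_comp L (hd.mono Ioc_subset_Icc_self))
    have heq : ∀ s ∈ Ioc 0 T, (N ^ m) (N (b s)) = -∑ k ∈ Finset.range j,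
        (N ^ (m + 1 + k)) (L (iteratedDerivWithin k δ (Icc 0 T) s)) := fun s hs => by
      rw [← ih (m := m + 1) (by omega) s hs, pow_succ]
      rfl
    have huniq := (uniqueDiffOn_Ioc 0 T t ht).eq_deriv _ hder1 (hder2.congr heq (heq t ht))
    rw [map_add] at huniq
    rw [eq_sub_of_add_eq huniq, Finset.sum_range_succ', neg_add, sub_eq_add_neg]
    simp only [show ∀ k, m + 1 + k = m + (k + 1) by omega, add_zero, iteratedDerivWithin_zero]

namespace IsSplit

variable [CompleteSpace Y₁] {S : ℝ → Y₁ →L[ℂ] Y₁}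

theorem hasPerturbationEstimate (h : IsSplit P Q E A N A₁) {p : ℕ} (hN : N ^ p = 0)
    (hS : IsC0Semigroup S) (hA₁ : IsGenerator S A₁) {T : ℝ} (hT : 0 < T) :
    HasPerturbationEstimate E A T p := by
  obtain ⟨M, ω, hM1, hω, hM⟩ := hS.exists_growthBound
  set K : ℝ := ∑ k ∈ Finset.range p, ‖N ^ k‖ with hK
  have hK0 : 0 ≤ K := Finset.sum_nonneg fun _ _ => norm_nonneg _
  set nP : ℝ := ‖(P : X →L[ℂ] Y₁ × Y₂)‖ with hnP
  set nQ : ℝ := ‖(Q : Z →L[ℂ] Y₁ × Y₂)‖ with hnQ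
  set nP' : ℝ := ‖(P.symm : Y₁ × Y₂ →L[ℂ] X)‖ with hnP'
  have hnP0 : 0 ≤ nP := ContinuousLinearMap.opNorm_nonneg _
  have hnQ0 : 0 ≤ nQ := ContinuousLinearMap.opNorm_nonneg _
  have hnP'0 : 0 ≤ nP' := ContinuousLinearMap.opNorm_nonneg _
  set G : ℝ := M * Real.exp (ω * T) with hG
  have hG0 : 0 ≤ G := by positivity
  have hPle : ∀ x, ‖P x‖ ≤ nP * ‖x‖ := (P : X →L[ℂ] Y₁ × Y₂).le_opNorm
  have hQle : ∀ z, ‖Q z‖ ≤ nQ * ‖z‖ := (Q : Z →L[ℂ] Y₁ × Y₂).le_opNorm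
  refine ⟨1 + nP' * (G * (nP + nQ * (T + 1)) + K * nQ), by positivity, fun δ x hδ hx => ?_⟩
  set σ := perturbationSize T p δ with hσ
  have hσ0 : 0 ≤ σ := perturbationSize_nonneg hT.le p δ
  have hx00 := norm_nonneg (x 0)
  rintro t ⟨ht0, htT⟩
  -- at `t = 0`, where the equation is not required, the estimate is trivial
  rcases ht0.eq_or_lt with rfl | ht0
  · have : 0 ≤ nP' * (G * (nP + nQ * (T + 1)) + K * nQ) := by positivity
    nlinarith
  have hsol : ∀ s ∈ Ioc 0 T, ∃ z, (x s, z) ∈ A.graph ∧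
      HasDerivWithinAt (fun r => Q (E (x r))) (Q (z + δ s)) (Ioc 0 T) s := fun s hs => by
    obtain ⟨hd, hder⟩ := hx.equation s hs
    exact ⟨_, A.mem_graph ⟨_, hd⟩, hasDerivWithinAt_clm_comp (Q : Z →L[ℂ] Y₁ × Y₂) hder⟩
  choose! z hz hder using hsol
  have hPx : ContinuousOn (fun s => P (x s)) (Icc 0 T) :=
    P.continuous.comp_continuousOn hx.continuousOn
  have hQδ : ContinuousOn (fun s => Q (δ s)) (Icc 0 T) :=
    Q.continuous.comp_continuousOn hδ.continuousOn
  -- the semigroup part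
  have ha : ‖(P (x t)).1‖ ≤ G * (nP * ‖x 0‖ + nQ * ((T + 1) * σ)) := by
    have h1 := hS.norm_le_of_ode hM hA₁ hω.le (by linarith) (a := fun s => (P (x s)).1)
      (b := fun s => (Q (z s)).1) (g := fun s => (Q (δ s)).1) ht0.le htT
      (continuous_fst.comp_continuousOn (hPx.mono (Icc_subset_Icc_right htT)))
      (continuous_fst.comp_continuousOn hQδ)
      (fun s hs => ((h.mem_graph _ _).1 (hz s ⟨hs.1, hs.2.le.trans htT⟩)).1) (fun s hs => by
        have hsT : s < T := hs.2.trans_le htT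
        have h2 := (hder s ⟨hs.1, hsT.le⟩).hasDerivAt (Ioc_mem_nhds hs.1 hsT)
        have h3 := hasDerivWithinAt_clm_comp (ContinuousLinearMap.fst ℂ Y₁ Y₂)
          (h2.hasDerivWithinAt (s := Ioi s))
        simpa [h.map_E] using h3)
    refine h1.trans (mul_le_mul_of_nonneg_left (add_le_add ?_ ?_) hG0)
    · exact (norm_fst_le _).trans (hPle _)
    · calc ∫ s in (0 : ℝ)..T, ‖(Q (δ s)).1‖ ≤ ∫ s in (0 : ℝ)..T, nQ * ‖δ s‖ := by
            refine intervalIntegral.integral_mono_on hT.le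
              ((continuous_fst.comp_continuousOn hQδ).norm.intervalIntegrable_of_Icc hT.le)
              ((hδ.continuousOn.norm.intervalIntegrable_of_Icc hT.le).const_mul _) fun s _ => ?_
            exact (norm_fst_le _).trans (hQle _)
        _ = nQ * ∫ s in (0 : ℝ)..T, ‖δ s‖ := intervalIntegral.integral_const_mul _ _
        _ ≤ _ := mul_le_mul_of_nonneg_left (integral_norm_le_perturbationSize hT hδ) hnQ0
  -- the nilpotent part
  have hb : ‖(P (x t)).2‖ ≤ K * (nQ * σ) := by
    have h1 := pow_apply_eq_neg_sum hT hN hδ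
      ((ContinuousLinearMap.snd ℂ Y₁ Y₂).comp (Q : Z →L[ℂ] Y₁ × Y₂)) (b := fun s => (P (x s)).2)
      (fun s hs => by
        have h3 := hasDerivWithinAt_clm_comp (ContinuousLinearMap.snd ℂ Y₁ Y₂) (hder s hs)
        have h4 := ((h.mem_graph _ _).1 (hz s hs)).2
        simpa [h.map_E, h4] using h3) (add_zero p) t ⟨ht0, htT⟩
    rw [pow_zero] at h1
    change (P (x t)).2 = _ at h1
    rw [h1, norm_neg, hK, Finset.sum_mul]
    refine norm_sum_le_of_le _ fun k hk => ?_
    rw [zero_add]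
    refine (ContinuousLinearMap.le_opNorm _ _).trans (mul_le_mul_of_nonneg_left ?_ (norm_nonneg _))
    refine ((norm_snd_le _).trans (hQle _)).trans (mul_le_mul_of_nonneg_left ?_ hnQ0)
    exact norm_iteratedDerivWithin_le_perturbationSize hT (Finset.mem_range.1 hk) hδ ⟨ht0.le, htT⟩
  have hPx' : ‖P (x t)‖ ≤ G * (nP * ‖x 0‖ + nQ * ((T + 1) * σ)) + K * (nQ * σ) :=
    max_le (ha.trans (le_add_of_nonneg_right (by positivity)))
      (hb.trans (le_add_of_nonneg_left (by positivity)))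
  have hxt : ‖x t‖ ≤ nP' * ‖P (x t)‖ := by
    simpa using (P.symm : Y₁ × Y₂ →L[ℂ] X).le_opNorm (P (x t))
  have e1 : 0 ≤ nP' * (G * (nQ * (T + 1)) + K * nQ) * ‖x 0‖ := by positivity
  have e2 : 0 ≤ nP' * (G * nP) * σ := by positivity
  calc ‖x t‖ ≤ nP' * (G * (nP * ‖x 0‖ + nQ * ((T + 1) * σ)) + K * (nQ * σ)) :=
        hxt.trans (mul_le_mul_of_nonneg_left hPx' hnP'0)
    _ ≤ _ := by nlinarith

end IsSplit

end Perturbation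

end DAE

/-! ### Coincidence of the indices -/

theorem mainTheorem8
    {X : Type u} [NormedAddCommGroup X] [InnerProductSpace ℂ X] [CompleteSpace X]
    {Z : Type v} [NormedAddCommGroup Z] [InnerProductSpace ℂ Z] [CompleteSpace Z]
    (E : X →L[ℂ] Z) (A : X →ₗ.[ℂ] Z) (hA_closed : A.IsClosed)
    (hA_dense : Dense (A.domain : Set X))
    {Y₁ : Type w} [NormedAddCommGroup Y₁] [InnerProductSpace ℂ Y₁] [CompleteSpace Y₁]
    {Y₂ : Type w} [NormedAddCommGroup Y₂] [InnerProductSpace ℂ Y₂] [CompleteSpace Y₂]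
    (N : Y₂ →L[ℂ] Y₂) (A₁ : Y₁ →ₗ.[ℂ] Y₁)
    (hW : DAE.IsWeierstrassForm E A N A₁) (hA₁ : DAE.GeneratesC0Semigroup A₁) :
    ∃ r p : ℕ,
      DAE.IsRadialityIndex E A r ∧
      DAE.IsResolventIndex E A p ∧
      DAE.IsNilpotencyIndex.{u, v, w} E A p ∧
      DAE.IsDifferentiationIndex E A p ∧
      DAE.IsChainIndex E A p ∧
      DAE.IsPerturbationIndex E A p ∧
      (Nontrivial Y₂ → r + 1 = p) ∧
      (Subsingleton Y₂ → r = 0 ∧ p = 0) := by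
  obtain ⟨T, hT0, hTadd, hTcont, hgen⟩ := hA₁
  have hT : DAE.IsC0Semigroup T := ⟨hT0, hTadd, hTcont⟩
  obtain ⟨P, Q, h⟩ := hW.exists_isSplit
  have hN := pow_nilpotencyClass hW.1
  have hchain : DAE.IsChainIndex E A (nilpotencyClass N) := h.isChainIndex hW.1
  have hlow : ∀ q < nilpotencyClass N, ∃ c w, DAE.IsExtendedChain E A q c w :=
    fun q hq => h.exists_isExtendedChain hq
  refine ⟨nilpotencyClass N - 1, nilpotencyClass N, ⟨?_, fun q hq => ?_⟩,
    ⟨h.hasResolventBound hN hT hgen, fun q hq => ?_⟩,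
    ⟨⟨Y₁, Y₂, _, _, ‹_›, _, _, ‹_›, N, A₁, hW⟩, ?_⟩,
    ⟨⟨?_, fun q hq => ?_⟩, h.hasUnderlyingODE hN hT hgen⟩, hchain,
    fun τ hτ => ⟨h.hasPerturbationEstimate hN hT hgen hτ, fun q hq => ?_⟩, fun _ => ?_, fun _ => ?_⟩
  · exact h.hasRadialityBound (pow_eq_zero_of_le (by omega) hN) hT hgen
  · by_contra! hlt
    obtain ⟨c, w, hc⟩ := hlow (q + 1) (by omega)
    exact hc.not_hasRadialityBound hq
  · by_contra! hlt
    obtain ⟨c, w, hc⟩ := hlow q hlt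
    exact hc.not_hasResolventBound hq
  · intro Y₁' Y₂' _ _ _ _ _ _ N' A₁' hW'
    obtain ⟨P', Q', h'⟩ := hW'.exists_isSplit
    exact (h'.isChainIndex hW'.1).unique hchain
  · refine DAE.determinesDerivative_iff_not_hasChainOfLength.2 fun hl => ?_
    have := hchain.1 hl
    omega
  · by_contra! hlt
    obtain ⟨c, w, hc⟩ := hlow q hlt
    refine DAE.determinesDerivative_iff_not_hasChainOfLength.1 hq
      ⟨q.succ_pos, c, hc.ne_zero, hc.ker, fun i hi => ?_⟩
    obtain ⟨hd, he⟩ := DAE.mem_graph_iff_exists.1 (hc.step i (by omega))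
    exact ⟨hd, he.symm⟩
  · by_contra! hlt
    obtain ⟨c, w, hc⟩ := hlow q hlt
    exact hc.not_hasPerturbationEstimate hτ hq
  · have := pos_nilpotencyClass_iff.2 hW.1
    omega
  · have : nilpotencyClass N = 0 := nilpotencyClass_eq_zero_of_subsingleton
    omega
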